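/- Let $\mathscr{M}=(\underline{M},\otimes,I)$ be a symmetric monoidal closed, locally presentable category, with initial object $\emptyset$, and let $X$ be a (small) set. **Precategories.** For $A,B\in X$ let $\mathcal{S}_X(A,B)$ be the category whose objects are the chains $s=(A_0,\dots,A_n)$ of elements of $X$ with $A_0=A$, $A_n=B$, and whose morphisms $s\to t$ delete interior letters (a morphism is a choice of interior positions of $s$ to be deleted so that $t$ remains). With concatenation $\otimes$ of chains as composition these are the hom-categories of a strict $2$-category $\mathcal{S}_X$. A *precategory* $\mathcal{F}\in\mathscr{M}_{\mathcal S}(X)$ is a normal lax functor $\mathcal{S}_X^{2\text{-op}}\to\mathscr{M}$: functors $\mathcal{S}_X(A,B)^{op}\to\mathscr{M}$ with natural laxity maps $\varphi:\mathcal{F}(s)\otimes\mathcal{F}(t)\to\mathcal{F}(s\otimes t)$ that are associative, where $\mathcal F(A)=I$ on one-letter chains and the corresponding laxity maps are the unit isomorphisms. Morphisms are the natural transformations compatible with the laxity maps. Let $I_X$ be the discrete $\mathscr{M}$-category ($I_X(A,A)=I$, $I_X(A,B)=\emptyset$ for $A\ne B$), regarded as a locally constant precategory. A *pointed* precategory is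 an object of $\mathscr{M}_{\mathcal S}(X)_*:=I_X\downarrow\mathscr{M}_{\mathcal S}(X)$; it has maps $I_A:I\to\mathcal{F}(A,A)$. **Strong unitality.** A *strongly unital* precategory is a precategory $\mathcal F$ with maps $I_A:I\to\mathcal{F}(A,A)$, $A\in X$, such that for all $A,B\in X$, every chain $s$ from $A$ to $B$, and every $\sigma:s\to(A,A)\otimes s$ (resp. every $\sigma:s\to s\otimes(B,B)$) in $\mathcal{S}_X(A,B)^{op}$, the two maps $$I\otimes\mathcal{F}(s)\xrightarrow{\cong}\mathcal{F}(s)\xrightarrow{\mathcal{F}(\sigma)}\mathcal{F}((A,A)\otimes s),\qquad I\otimes\mathcal{F}(s)\xrightarrow{I_A\otimes\mathrm{Id}}\mathcal{F}(A,A)\otimes\mathcal{F}(s)\xrightarrow{\varphi}\mathcal{F}((A,A)\otimes s)$$ (resp. the two analogous maps $\mathcal{F}(s)\otimes I\rightrightarrows\mathcal{F}(s\otimes(B,B))$) are equal. Morphisms are the morphisms of precategories that preserve the maps $I_A$. The maps $I_A$ extend uniquely to a map $I_X\to\mathcal F$, which gives a fully faithful forgetful functor $\mathcal{U}:\mathscr{M}_{\mathcal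 S}(X)_{su}\to\mathscr{M}_{\mathcal S}(X)_*$. Let $S$ be the set of all unity constraints $i=(A,s,\sigma)$ and $i=(s,B,\sigma)$ as above. **The projections $P_i$ and their gluing.** Fix a limit ordinal $\lambda>0$ (for example an infinite regular cardinal). For $i=(A,s,\sigma)\in S$ put $z=(A,A)\otimes s$, and let $\Upsilon_z$ be the left adjoint of the evaluation $\mathscr{M}_{\mathcal S}(X)_*\to\mathscr{M}$ at $z$. For a pointed $\mathcal{F}$ define a continuous $\lambda$-sequence by $\mathcal{F}_0=\mathcal{F}$ and by letting $\mathcal{F}_{k}\to\mathcal{F}_{k+1}$ be the pushout in $\mathscr{M}_{\mathcal S}(X)_*$ of $\Upsilon_z(j_k)$ along the counit $\Upsilon_z(\mathcal{F}_k(z))\to\mathcal{F}_k$, where $j_k:\mathcal{F}_k(z)\to m_k$ is the coequalizer in $\mathscr{M}$ of the two displayed maps $I\otimes\mathcal{F}_k(s)\rightrightarrows\mathcal{F}_k(z)$. Let $P_i(\mathcal{F})=\mathrm{colim}_{k<\lambda}\mathcal{F}_k$ and let $\eta_i:\mathcal{F}\to P_i(\mathcal{F})$ be the canonical map. For $i=(s,B,\sigma)$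 one proceeds in the same way with $z=s\otimes(B,B)$. The *gluing* $(\Phi,\eta)$ of the $(P_i,\eta_i)_{i\in S}$ is given by $\Phi(\mathcal{F})=\mathrm{colim}_{k<\lambda}\mathcal{G}_k$ for the continuous $\lambda$-sequence with $\mathcal{G}_0=\mathcal{F}$ in which $\mathcal{G}_k\to\mathcal{G}_{k+1}$ is the canonical map to the wide pushout of all $\eta_i:\mathcal{G}_k\to P_i(\mathcal{G}_k)$, $i\in S$; $\eta:\mathcal{F}\to\Phi(\mathcal{F})$ is the canonical map. **Theorem.** These constructions exist: there are endofunctors $P_i$ of $\mathscr{M}_{\mathcal S}(X)_*$ with natural transformations $\eta_i:\mathrm{Id}\to P_i$ $(i\in S)$ whose components arise as described, and for every such family there is an endofunctor $\Phi$ with a natural transformation $\eta:\mathrm{Id}\to\Phi$ whose components arise as described. For all such $(P_i,\eta_i)_{i\in S}$ and $(\Phi,\eta)$: 1. every $\Phi(\mathcal{F})$ is strongly unital, i.e. $\Phi$ factors up to isomorphism as $\mathcal{U}\circ\Phi'$ with $\Phi':\mathscr{M}_{\mathcal S}(X)_*\to\mathscr{M}_{\mathcal S}(X)_{su}$; the functor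 $\Phi'$ is left adjoint to $\mathcal{U}$, and $\eta$ is (under this isomorphism) the unit of the adjunction; 2. for every pointed $\mathcal{F}$ and all $A,B\in X$ the component $\eta_{(A,B)}:\mathcal{F}(A,B)\to\Phi(\mathcal{F})(A,B)$ is an isomorphism in $\mathscr{M}$; 3. $(\Phi,\eta)$ is a monadic projection from $\mathscr{M}_{\mathcal S}(X)_*$ to its full subcategory $\mathscr{M}_{\mathcal S}(X)_{su}$ (the essential image of $\mathcal{U}$): every $\Phi(\mathcal{F})$ lies in this subcategory, $\eta_{\mathcal{F}}$ is an isomorphism for every $\mathcal{F}$ in it, and $\Phi(\eta_{\mathcal{F}})$ is an isomorphism for every $\mathcal{F}$. -/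

import Mathlib

open CategoryTheory CategoryTheory.Limits MonoidalCategory

universe w v u

namespace CoSegal

/-! ### The strict 2-category of chains -/

/-- Insertions of letters into words. An element of `Ins l l'` exhibits `l'` as obtained from `l` by
inserting letters; equivalently it is an order preserving injection of the positions of `l` into the
positions of `l'` that preserves letters, the positions not in the image being the deleted ones when
one reads the insertion backwards as a deletion from `l'` to `l`. -/
inductive Ins {X : Type w} : List X → List X → Type w
  | nil : Ins [] []
  | keep (a : X) {l l' : List X} (f : Ins l l') : Ins (a :: l) (a :: l')
  | insert (a : X) {l l' : List X} (f : Ins l l') : Ins l (a :: l')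

namespace Ins

variable {X : Type w}

/-- The identity (nothing is inserted). -/
def id : (l : List X) → Ins l l
  | [] => nil
  | a :: l => keep a (id l)

/-- Composition of insertions. -/
def comp {l₁ l₂ l₃ : List X} (f : Ins l₁ l₂) (g : Ins l₂ l₃) : Ins l₁ l₃ :=
  match l₁, l₂, l₃, f, g with
  | _, _, _, f, nil => f
  | _, _, _, f, insert a g => insert a (comp f g)
  | _, _, _, keep _ f, keep a g => keep a (comp f g)
  | _, _, _, insert _ f, keep a g => insert a (comp f g)

theorem id_comp {l l' : List X} (f : Ins l l') : comp (id l) f = f := by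
  induction f with
  | nil => rfl
  | keep a f ih => simp only [id, comp, ih]
  | @insert a l l' f ih =>
    cases l with
    | nil => simp only [comp, ih]
    | cons b l => simp only [comp, ih]

theorem comp_id {l l' : List X} (f : Ins l l') : comp f (id l') = f := by
  induction f with
  | nil => rfl
  | keep a f ih => simp only [id, comp, ih]
  | insert a f ih => simp only [id, comp, ih]

theorem comp_assoc {l₁ l₂ l₃ l₄ : List X} (f : Ins l₁ l₂) (g : Ins l₂ l₃) (h : Ins l₃ l₄) :
    comp (comp f g) h = comp f (comp g h) := by
  induction h generalizing l₁ l₂ with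
  | nil => simp only [comp]
  | insert a h ih => simp only [comp, ih]
  | keep a h ih =>
    cases g with
    | insert _ g => simp only [comp, ih]
    | keep _ g =>
      cases f with
      | insert _ f => simp only [comp, ih]
      | keep _ f => simp only [comp, ih]

/-- Juxtaposition of insertions. -/
def append {l₁ l₁' l₂ l₂' : List X} (f : Ins l₁ l₁') (g : Ins l₂ l₂') :
    Ins (l₁ ++ l₂) (l₁' ++ l₂') :=
  match l₁, l₁', f with
  | _, _, nil => g
  | _, _, keep a f => keep a (append f g)
  | _, _, insert a f => insert a (append f g)

/-- The insertion of all the letters of a word into the empty word. -/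
def ofNil : (l : List X) → Ins [] l
  | [] => nil
  | a :: l => insert a (ofNil l)

theorem eq_ofNil {l : List X} (f : Ins [] l) : f = ofNil l := by
  induction l with
  | nil => cases f; rfl
  | cons a l ih => cases f with | insert _ f => rw [ofNil, ih f]

end Ins

/-- A chain `(A, x₁, …, xₙ, B)` from `A` to `B` of elements of `X`, of positive length `n + 1`; it is
recorded by its interior letters `x₁, …, xₙ`. These are the 1-morphisms `A ⟶ B` of the strict
2-category of chains, except for the identities, which are the one-letter chains `(A)`. -/
structure Chain {X : Type w} (A B : X) : Type w where
  /-- the interior letters -/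
  mid : List X

namespace Chain

variable {X : Type w}

/-- The category `𝒮_X(A, B)ᵒᵖ` (restricted to chains of positive length): a 2-morphism of `𝒮_X`
deletes interior letters of a chain, i.e. it is a surjection in `Δ_epi` between the sets of edges
compatible with the vertices; in the opposite category a morphism `s ⟶ t` inserts letters. -/
instance category (A B : X) : Category.{w} (Chain A B) where
  Hom s t := Ins s.mid t.mid
  id s := Ins.id s.mid
  comp f g := Ins.comp f g
  id_comp f := Ins.id_comp f
  comp_id f := Ins.comp_id f
  assoc f g h := Ins.comp_assoc f g h

/-- The chain `(A, B)`. -/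
def edge (A B : X) : Chain A B := ⟨[]⟩

/-- Concatenation `(A, …, B) ⊗ (B, …, C) = (A, …, B, …, C)`: composition of 1-morphisms. -/
def concat {A B C : X} (s : Chain A B) (t : Chain B C) : Chain A C := ⟨s.mid ++ B :: t.mid⟩

/-- Concatenation of 2-morphisms. -/
def concatMap {A B C : X} {s s' : Chain A B} {t t' : Chain B C} (f : s ⟶ s') (g : t ⟶ t') :
    s.concat t ⟶ s'.concat t' :=
  Ins.append (l₁ := s.mid) (l₁' := s'.mid) f (Ins.keep B (l := t.mid) (l' := t'.mid) g)

theorem concat_assoc {A B C D : X} (r : Chain A B) (s : Chain B C) (t : Chain C D) :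
    (r.concat s).concat t = r.concat (s.concat t) := by
  simp [concat]

/-- The unique morphism of `𝒮_X(A, B)ᵒᵖ` from `(A, B)` to a given chain. -/
def fromEdge {A B : X} (s : Chain A B) : edge A B ⟶ s := Ins.ofNil s.mid

theorem fromEdge_unique {A B : X} {s : Chain A B} (f g : edge A B ⟶ s) : f = g :=
  (Ins.eq_ofNil (l := s.mid) f).trans (Ins.eq_ofNil (l := s.mid) g).symm

end Chain

/-! ### Precategories -/

/-- A co-Segal precategory with set of objects `X`: a normal lax functor `𝒮_X^{2-op} → M`. Normality
says that the value at every identity 1-morphism `(A)` is the unit object and that the laxity maps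
with an identity 1-morphism are the unitors of `M`; moreover no 2-morphism other than the identity
starts or ends at `(A)`. So the remaining data are those on the chains of positive length. -/
structure Precat (M : Type u) [Category.{v} M] [MonoidalCategory M] (X : Type w) where
  /-- the components `𝒮_X(A, B)ᵒᵖ ⥤ M` -/
  diag (A B : X) : Chain A B ⥤ M
  /-- the laxity maps -/
  lax {A B C : X} (s : Chain A B) (t : Chain B C) :
    (diag A B).obj s ⊗ (diag B C).obj t ⟶ (diag A C).obj (s.concat t)
  lax_naturality {A B C : X} {s s' : Chain A B} {t t' : Chain B C} (f : s ⟶ s') (g : t ⟶ t') :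
    ((diag A B).map f ⊗ₘ (diag B C).map g) ≫ lax s' t' =
      lax s t ≫ (diag A C).map (Chain.concatMap f g)
  lax_assoc {A B C D : X} (r : Chain A B) (s : Chain B C) (t : Chain C D) :
    (lax r s ▷ (diag C D).obj t) ≫ lax (r.concat s) t ≫
        (diag A D).map (eqToHom (Chain.concat_assoc r s t)) =
      (α_ _ _ _).hom ≫ ((diag A B).obj r ◁ lax s t) ≫ lax r (s.concat t)

namespace Precat

variable {M : Type u} [Category.{v} M] [MonoidalCategory M] {X : Type w}

/-- A morphism of precategories (with the same set of objects): natural transformations between the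
components that are compatible with the laxity maps. -/
@[ext]
structure Hom (F G : Precat M X) where
  /-- the components -/
  app (A B : X) : F.diag A B ⟶ G.diag A B
  lax_comm {A B C : X} (s : Chain A B) (t : Chain B C) :
    F.lax s t ≫ (app A C).app (s.concat t) =
      ((app A B).app s ⊗ₘ (app B C).app t) ≫ G.lax s t

instance category : Category (Precat M X) where
  Hom F G := Hom F G
  id F := { app := fun _ _ => 𝟙 _, lax_comm := by intros; simp }
  comp f g :=
    { app := fun A B => f.app A B ≫ g.app A B
      lax_comm := by
        intro A B C s t
        rw [NatTrans.comp_app, ← Category.assoc, f.lax_comm, Category.assoc, g.lax_comm]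
        simp [← Category.assoc] }
  id_comp f := by apply Hom.ext; funext A B; exact Category.id_comp _
  comp_id f := by apply Hom.ext; funext A B; exact Category.comp_id _
  assoc f g h := by apply Hom.ext; funext A B; exact Category.assoc _ _ _

@[simp]
theorem id_app (F : Precat M X) (A B : X) : Hom.app (𝟙 F) A B = 𝟙 _ := rfl

@[simp]
theorem comp_app {F G H : Precat M X} (f : F ⟶ G) (g : G ⟶ H) (A B : X) :
    Hom.app (f ≫ g) A B = f.app A B ≫ g.app A B := rfl

@[ext]
theorem hom_ext {F G : Precat M X} {f g : F ⟶ G}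
    (h : ∀ (A B : X) (s : Chain A B), (f.app A B).app s = (g.app A B).app s) : f = g := by
  apply Hom.ext
  funext A B
  ext s
  exact h A B s

/-- Evaluation at a 1-morphism. -/
def ev (M : Type u) [Category.{v} M] [MonoidalCategory M] {X : Type w} {A B : X} (s : Chain A B) :
    Precat M X ⥤ M where
  obj F := (F.diag A B).obj s
  map f := (f.app A B).app s

/-- For a family of maps `I_A : I ⟶ F(A, A)`, the composite
`I ⊗ F(s) ⟶ F(A, A) ⊗ F(s) ⟶ F((A, A) ⊗ s)`. -/
def leftMul (F : Precat M X) (e : ∀ A, 𝟙_ M ⟶ (F.diag A A).obj (Chain.edge A A)) {A B : X}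
    (s : Chain A B) :
    𝟙_ M ⊗ (F.diag A B).obj s ⟶ (F.diag A B).obj ((Chain.edge A A).concat s) :=
  (e A ▷ (F.diag A B).obj s) ≫ F.lax (Chain.edge A A) s

/-- For a family of maps `I_A : I ⟶ F(A, A)`, the composite
`F(s) ⊗ I ⟶ F(s) ⊗ F(B, B) ⟶ F(s ⊗ (B, B))`. -/
def rightMul (F : Precat M X) (e : ∀ A, 𝟙_ M ⟶ (F.diag A A).obj (Chain.edge A A)) {A B : X}
    (s : Chain A B) :
    (F.diag A B).obj s ⊗ 𝟙_ M ⟶ (F.diag A B).obj (s.concat (Chain.edge B B)) :=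
  ((F.diag A B).obj s ◁ e B) ≫ F.lax s (Chain.edge B B)

end Precat

/-! ### The discrete category `I_X` and pointed precategories -/

variable {M : Type u} [Category.{v} M] [MonoidalCategory M]

section Initial

instance hasInitial_of_isLocallyPresentable [h : IsLocallyPresentable.{w} M] : HasInitial M := by
  obtain ⟨κ, hκ, h'⟩ := h.exists_cardinal
  have : HasColimitsOfSize.{0, 0} M := hasColimitsOfSizeShrink.{0, 0, w, w} M
  infer_instance

variable [SymmetricCategory M] [MonoidalClosed M]

/-- In a symmetric monoidal closed category `∅ ⊗ Y` is initial. -/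
noncomputable def isInitialTensorRight {Z : M} (hZ : IsInitial Z) (Y : M) : IsInitial (Z ⊗ Y) :=
  IsInitial.isInitialObj (tensorRight Y) Z hZ

/-- In a symmetric monoidal closed category `Y ⊗ ∅` is initial. -/
noncomputable def isInitialTensorLeft {Z : M} (hZ : IsInitial Z) (Y : M) : IsInitial (Y ⊗ Z) :=
  IsInitial.isInitialObj (tensorLeft Y) Z hZ

end Initial

section Discrete

variable [HasInitial M] {X : Type w}

open scoped Classical in
variable (M) in
/-- The hom-objects of the discrete `M`-category `I_X`: the unit if `A = B`, otherwise initial. -/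
noncomputable def discHom (A B : X) : M := if A = B then 𝟙_ M else ⊥_ M

variable (M) in
/-- `I_X(A, A) = I`. -/
noncomputable def discSelf (A : X) : 𝟙_ M ≅ discHom M A A := eqToIso (if_pos rfl).symm

/-- `I_X(A, B) = ∅` for `A ≠ B`. -/
noncomputable def discInitial {A B : X} (h : A ≠ B) : IsInitial (discHom M A B) :=
  initialIsInitial.ofIso (eqToIso (if_neg h).symm)

variable [SymmetricCategory M] [MonoidalClosed M]

open scoped Classical in
variable (M) in
/-- The composition of `I_X`: either `I ⊗ I ≅ I`, or the map from an initial object. -/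
noncomputable def discComp (A B C : X) : discHom M A B ⊗ discHom M B C ⟶ discHom M A C :=
  if h : A = B then
    eqToHom (by rw [h]) ≫ ((discSelf M B).inv ▷ discHom M B C) ≫ (λ_ _).hom ≫ eqToHom (by rw [h])
  else (isInitialTensorRight (discInitial h) _).to _

variable (M) in
theorem discComp_self (A C : X) :
    discComp M A A C = ((discSelf M A).inv ▷ discHom M A C) ≫ (λ_ _).hom := by
  simp [discComp]

variable (M) in
theorem discComp_assoc (A B C D : X) :
    (discComp M A B C ▷ discHom M C D) ≫ discComp M A C D =
      (α_ _ _ _).hom ≫ (discHom M A B ◁ discComp M B C D) ≫ discComp M A B D := by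
  by_cases h : A = B
  · subst h
    rw [discComp_self, discComp_self]
    have h1 := whisker_exchange_assoc (discSelf M A).inv (discComp M A C D) (λ_ _).hom
    simp [h1]
  · exact (isInitialTensorRight (isInitialTensorRight (discInitial h) _) _).hom_ext _ _

variable (M X) in
/-- The discrete `M`-category `I_X`, regarded as a locally constant precategory. -/
noncomputable def disc : Precat M X where
  diag A B := (Functor.const _).obj (discHom M A B)
  lax {A B C} _ _ := discComp M A B C
  lax_naturality := by intros; simp
  lax_assoc {A B C D} r s t := by
    simpa using discComp_assoc M A B C D

end Discrete

section Pointed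

variable (M) [SymmetricCategory M] [MonoidalClosed M] [HasInitial M] (X : Type w)

/-- The category `I_X ↓ M_S(X)` of pointed precategories. -/
abbrev Pointed := Under (disc M X)

variable {M X}

/-- The map `I_A : I ⟶ F(A, A)` of a pointed precategory: `I = I_X(A, A) ⟶ F(A, A)`. -/
noncomputable def Pointed.pt (F : Pointed M X) (A : X) :
    𝟙_ M ⟶ (F.right.diag A A).obj (Chain.edge A A) :=
  (discSelf M A).hom ≫ (F.hom.app A A).app (Chain.edge A A)

/-- Evaluation of pointed precategories at a 1-morphism. -/
noncomputable def Pointed.ev (M : Type u) [Category.{v} M] [MonoidalCategory M]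
    [SymmetricCategory M] [MonoidalClosed M] [HasInitial M] {X : Type w} {A B : X}
    (s : Chain A B) : Pointed M X ⥤ M :=
  Under.forget _ ⋙ Precat.ev M s

end Pointed

/-! ### Strongly unital precategories -/

section StronglyUnital

/-- A strongly unital precategory: for every `A` there is a map `I_A : I ⟶ F(A, A)` such that all
left and right invariance diagrams commute. -/
structure StronglyUnital (M : Type u) [Category.{v} M] [MonoidalCategory M] (X : Type w) where
  /-- the underlying precategory -/
  toPrecat : Precat M X
  /-- the unities `I_A` -/
  unit (A : X) : 𝟙_ M ⟶ (toPrecat.diag A A).obj (Chain.edge A A)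
  left_unital {A B : X} (s : Chain A B) (σ : s ⟶ (Chain.edge A A).concat s) :
    toPrecat.leftMul unit s = (λ_ _).hom ≫ (toPrecat.diag A B).map σ
  right_unital {A B : X} (s : Chain A B) (σ : s ⟶ s.concat (Chain.edge B B)) :
    toPrecat.rightMul unit s = (ρ_ _).hom ≫ (toPrecat.diag A B).map σ

namespace StronglyUnital

variable {X : Type w}

/-- Morphisms of strongly unital precategories: morphisms of precategories that take unity to
unity. -/
@[ext]
structure Hom (F G : StronglyUnital M X) where
  /-- the morphism of precategories -/
  toHom : F.toPrecat ⟶ G.toPrecat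
  unit_comm (A : X) : F.unit A ≫ (toHom.app A A).app (Chain.edge A A) = G.unit A

instance category : Category (StronglyUnital M X) where
  Hom F G := Hom F G
  id F := { toHom := 𝟙 _, unit_comm := by simp }
  comp f g :=
    { toHom := f.toHom ≫ g.toHom
      unit_comm := by
        intro A
        rw [Precat.comp_app, NatTrans.comp_app, ← Category.assoc, f.unit_comm, g.unit_comm] }
  id_comp f := by apply Hom.ext; exact Category.id_comp _
  comp_id f := by apply Hom.ext; exact Category.comp_id _
  assoc f g h := by apply Hom.ext; exact Category.assoc _ _ _

variable [HasInitial M]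

open scoped Classical in
/-- The map `I_X(A, B) ⟶ F(A, B)` given by the unity if `A = B`, and the map from an initial object
otherwise. -/
noncomputable def pointEdge (F : StronglyUnital M X) (A B : X) :
    discHom M A B ⟶ (F.toPrecat.diag A B).obj (Chain.edge A B) :=
  if h : A = B then by
    subst h
    exact (discSelf M A).inv ≫ F.unit A
  else (discInitial h).to _

/-- The components `I_X(A, B) ⟶ F(s)` of the morphism `I_X ⟶ F` that the unities determine. -/
noncomputable def pointApp (F : StronglyUnital M X) {A B : X} (s : Chain A B) :
    discHom M A B ⟶ (F.toPrecat.diag A B).obj s :=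
  F.pointEdge A B ≫ (F.toPrecat.diag A B).map (Chain.fromEdge s)

theorem pointApp_self (F : StronglyUnital M X) {A : X} (s : Chain A A) :
    F.pointApp s =
      (discSelf M A).inv ≫ F.unit A ≫ (F.toPrecat.diag A A).map (Chain.fromEdge s) := by
  simp [pointApp, pointEdge]

theorem pointApp_map (F : StronglyUnital M X) {A B : X} {s t : Chain A B} (f : s ⟶ t) :
    F.pointApp s ≫ (F.toPrecat.diag A B).map f = F.pointApp t := by
  rw [pointApp, Category.assoc, ← Functor.map_comp,
    Chain.fromEdge_unique (Chain.fromEdge s ≫ f) (Chain.fromEdge t), ← pointApp]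

variable [SymmetricCategory M] [MonoidalClosed M]

theorem lax_pointApp (F : StronglyUnital M X) {A B C : X} (s : Chain A B) (t : Chain B C) :
    discComp M A B C ≫ F.pointApp (s.concat t) =
      (F.pointApp s ⊗ₘ F.pointApp t) ≫ F.toPrecat.lax s t := by
  by_cases h : A = B
  · subst h
    let σ : t ⟶ (Chain.edge A A).concat t := Ins.insert A (Ins.id t.mid)
    have e1 : (F.pointApp s ⊗ₘ F.pointApp t) =
        ((discSelf M A).inv ⊗ₘ F.pointApp t) ≫ (F.unit A ▷ _) ≫
          ((F.toPrecat.diag A A).map (Chain.fromEdge s) ⊗ₘ (F.toPrecat.diag A C).map (𝟙 t)) := by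
      rw [pointApp_self]
      simp only [MonoidalCategory.tensorHom_def, comp_whiskerRight, CategoryTheory.Functor.map_id,
        MonoidalCategory.whiskerLeft_id, Category.comp_id, Category.assoc]
      rw [whisker_exchange_assoc, whisker_exchange]
    rw [e1, Category.assoc, Category.assoc, F.toPrecat.lax_naturality]
    have h2 := F.left_unital t σ
    rw [Precat.leftMul] at h2
    rw [reassoc_of% h2, ← Functor.map_comp, discComp_self, MonoidalCategory.tensorHom_def, Category.assoc,
      Category.assoc, leftUnitor_naturality_assoc, pointApp_map]
  · exact (isInitialTensorRight (discInitial h) _).hom_ext _ _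

/-- The forgetful functor from strongly unital to pointed precategories. -/
noncomputable def toPointed : StronglyUnital M X ⥤ Pointed M X where
  obj F := Under.mk (Y := F.toPrecat)
    ({ app := fun _ _ =>
        { app := fun s => F.pointApp s
          naturality := fun _ _ f => (Category.id_comp _).trans (F.pointApp_map f).symm }
       lax_comm := fun s t => F.lax_pointApp s t } : Precat.Hom (disc M X) F.toPrecat)
  map {F G} f := Under.homMk f.toHom (by
    ext A B s
    change F.pointApp s ≫ (f.toHom.app A B).app s = G.pointApp s
    by_cases h : A = B
    · subst h
      rw [pointApp_self, pointApp_self]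
      simp [← f.unit_comm A]
    · exact (discInitial h).hom_ext _ _)

theorem toPointed_pt (F : StronglyUnital M X) (A : X) :
    Pointed.pt (toPointed.obj F) A = F.unit A := by
  change (discSelf M A).hom ≫ F.pointApp (Chain.edge A A) = _
  rw [pointApp_self, Chain.fromEdge_unique (Chain.fromEdge (Chain.edge A A)) (𝟙 _)]
  simp

instance : (toPointed (M := M) (X := X)).Faithful where
  map_injective h := Hom.ext (congrArg (fun k => k.right) h)

instance : (toPointed (M := M) (X := X)).Full where
  map_surjective {F G} k := by
    refine ⟨{ toHom := k.right, unit_comm := fun A => ?_ }, rfl⟩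
    rw [← toPointed_pt F, ← toPointed_pt G, Pointed.pt, Pointed.pt, ← Under.w k]
    exact Category.assoc _ _ _

end StronglyUnital

end StronglyUnital

/-! ### Gluing and monadic projections -/

section Gluing

variable {C : Type u} [Category.{v} C]

/-- A monadic projection `(P, η)` from a category to the full subcategory of the objects that
satisfy `A`. -/
structure IsMonadicProjection (A : ObjectProperty C) (P : C ⥤ C) (η : 𝟭 C ⟶ P) : Prop where
  mem (F : C) : A (P.obj F)
  isIso_of_mem (F : C) (hF : A F) : IsIso (η.app F)
  isIso_map (F : C) : IsIso (P.map (η.app F))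

/-- The maps `δ : F ⟶ G` that exhibit `G` as a wide pushout of the family of all
`η_i : F ⟶ P_i(F)`. -/
def gluingStep {S : Type*} (P : S → C ⥤ C) (η : ∀ i, 𝟭 C ⟶ P i) : MorphismProperty C :=
  fun F G δ => ∃ (ε : ∀ i, (P i).obj F ⟶ G) (h : ∀ i, (η i).app F ≫ ε i = δ),
    Nonempty (IsColimit (WidePushoutShape.mkCocone
      (F := WidePushoutShape.wideSpan F (fun i => (P i).obj F) (fun i => (η i).app F)) δ ε h))

/-- `(Q, η)` is the gluing of the family `(P_i, η_i)`, with index ordinal `J`: each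
`η_F : F ⟶ Q(F)` is the canonical map to the colimit of a (continuous) sequence
`F = F₀ ⟶ F₁ ⟶ ⋯ ⟶ F_k ⟶ ⋯`, `k ∈ J`, in which `F_k ⟶ F_{k+1}` is the map to the wide pushout of
the `η_i : F_k ⟶ P_i(F_k)`. -/
def IsGluing (J : Type*) [LinearOrder J] [OrderBot J] [SuccOrder J] [WellFoundedLT J]
    {S : Type*} (P : S → C ⥤ C) (ηP : ∀ i, 𝟭 C ⟶ P i) (Q : C ⥤ C) (η : 𝟭 C ⟶ Q) : Prop :=
  ∀ F : C, (gluingStep P ηP).transfiniteCompositionsOfShape J (η.app F)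

end Gluing

/-! ### Enforcing a single unity constraint -/

section Enforcing

/-- The set `S` of all unity constraints: the triples `(A, s, σ : s ⟶ (A, A) ⊗ s)` and the triples
`(s, B, σ : s ⟶ s ⊗ (B, B))`, for all `(A, B)` and all chains `s` from `A` to `B`. -/
inductive UnityConstraint (X : Type w) : Type w
  | left {A B : X} (s : Chain A B) (σ : s ⟶ (Chain.edge A A).concat s)
  | right {A B : X} (s : Chain A B) (σ : s ⟶ s.concat (Chain.edge B B))

variable [SymmetricCategory M] [MonoidalClosed M] [HasInitial M] {X : Type w}

/-- One step of the enforcing process at a 1-morphism `z`, for two parallel maps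
`a, b : T ⟶ F(z)`: with `j : F(z) ⟶ m` their coequalizer in `M` and `Υ` the left adjoint of the
evaluation at `z`, the map `δ : F ⟶ G` is the pushout in pointed precategories of
`Υ(j) : Υ(F(z)) ⟶ Υ(m)` along the transpose `Υ(F(z)) ⟶ F` of the identity. -/
def IsEnforcingPushout {A B : X} (z : Chain A B) {F G : Pointed M X} {T : M}
    (a b : T ⟶ (Pointed.ev M z).obj F) (δ : F ⟶ G) : Prop :=
  ∃ (Υ : M ⥤ Pointed M X) (adj : Υ ⊣ Pointed.ev M z) (m : M)
    (j : (Pointed.ev M z).obj F ⟶ m) (hj : a ≫ j = b ≫ j) (_ : Nonempty (IsColimit (Cofork.ofπ j hj)))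
    (ξ : Υ.obj m ⟶ G), IsPushout (adj.counit.app F) (Υ.map j) δ ξ

/-- One step `F ⟶ G` of the process that enforces a given unity constraint. -/
def enforcingStep : UnityConstraint X → MorphismProperty (Pointed M X)
  | .left (A := A) (B := B) s σ => fun F _ δ =>
      IsEnforcingPushout ((Chain.edge A A).concat s)
        ((λ_ _).hom ≫ (F.right.diag A B).map σ) (F.right.leftMul F.pt s) δ
  | .right (A := A) (B := B) s σ => fun F _ δ =>
      IsEnforcingPushout (s.concat (Chain.edge B B))
        ((ρ_ _).hom ≫ (F.right.diag A B).map σ) (F.right.rightMul F.pt s) δ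

/-- `(P, η)` is the projection that enforces the unity constraint `i`, built by the process of index
ordinal `J`: each `η_F : F ⟶ P(F)` is the canonical map to the colimit of a (continuous) sequence
`F = F₀ ⟶ F₁ ⟶ ⋯ ⟶ F_k ⟶ ⋯`, `k ∈ J`, in which `F_k ⟶ F_{k+1}` is a step of the process. -/
def IsUnitEnforcing (J : Type*) [LinearOrder J] [OrderBot J] [SuccOrder J] [WellFoundedLT J]
    (i : UnityConstraint X) (P : Pointed M X ⥤ Pointed M X) (η : 𝟭 _ ⟶ P) : Prop :=
  ∀ F : Pointed M X, (enforcingStep i).transfiniteCompositionsOfShape J (η.app F)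

end Enforcing

end CoSegal

/-! Everything about `η` follows from two facts: each `Φ(F)` satisfies all unity constraints, and
`η_F` is local, i.e. precomposition with it is bijective on maps into any pointed precategory that
satisfies all of them (`AllHold`). The adjunction and the monadic projection are then formal
(`exists_adjunction_of_isLocal`, `isMonadicProjection_of_isLocal`).

Locality: a map out of an enforcing pushout is a map out of `F` that coequalizes the two compared
maps (`IsEnforcingPushout.bijective`), and every map into an object satisfying the constraint does
so. Local maps are stable under wide pushouts and transfinite compositions.

Validity of the constraints: each step coequalizes the two maps formed at its source. Evaluations
preserve filtered colimits and every stage has a successor, so the two maps agree in the colimit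
(`holds_of_transfiniteComposition`). Locality and validity together also make the constructions
functorial (`exists_functor_of_isLocal`).

Two-letter chains: both maps of a constraint land in the value at a concatenation, which has at
least three letters. Making all those values terminal yields a truncation that satisfies every
constraint, while maps into it still see the two-letter values; locality against truncations
therefore inverts the two-letter components (`isIso_edgeApp_of_isLocal`).

The remaining work is existence of pushouts and of the left adjoints of evaluations, where local
presentability enters through cocompleteness. Sifted colimits of precategories are computed
pointwise because the tensor product preserves colimits in each variable; free precategories are
coproducts over paths of chains. Monadicity and adjoint lifting then give all small colimits. -/

/-! ### Siftedness of the walking reflexive pair. -/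

namespace CategoryTheory.Limits.WalkingReflexivePair

/-- Two parallel morphisms to `zero` are equalized up to a zigzag by a morphism to `one`. -/
theorem exists_lift_or_lift_symm {a : WalkingReflexivePair} (f f' : Hom a zero) :
    ∃ h : a ⟶ one, (h ≫ Hom.left = (f : a ⟶ zero) ∧ h ≫ Hom.right = f') ∨
      (h ≫ Hom.left = f' ∧ h ≫ Hom.right = f) := by
  cases f with
  | left =>
    cases f' with
    | left => exact ⟨Hom.leftCompReflexion, Or.inl ⟨rfl, rfl⟩⟩
    | right => exact ⟨𝟙 _, Or.inl ⟨rfl, rfl⟩⟩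
  | right =>
    cases f' with
    | left => exact ⟨𝟙 _, Or.inr ⟨rfl, rfl⟩⟩
    | right => exact ⟨Hom.rightCompReflexion, Or.inl ⟨rfl, rfl⟩⟩
  | id =>
    cases f' with
    | id => exact ⟨Hom.reflexion, Or.inl ⟨rfl, rfl⟩⟩

theorem exists_hom_zero (a : WalkingReflexivePair) : Nonempty (a ⟶ zero) := by
  cases a
  · exact ⟨𝟙 _⟩
  · exact ⟨Hom.left⟩

/-- Any cospan under `(a, b)` can be pushed to one with apex `zero`; its legs are then changed one
at a time through a cospan with apex `one`. Siftedness is what makes reflexive coequalizers of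
precategories pointwise. -/
instance isSifted : IsSifted WalkingReflexivePair where
  nonempty := ⟨zero⟩
  out := by
    rintro ⟨a, b⟩
    let mk {c : WalkingReflexivePair} (f : a ⟶ c) (g : b ⟶ c) :
        StructuredArrow (a, b) (Functor.diag WalkingReflexivePair) :=
      StructuredArrow.mk (Y := c) (Prod.mkHom f g)
    have step {c d : WalkingReflexivePair} (k : c ⟶ d) (f : a ⟶ c) (g : b ⟶ c) :
        Zigzag (mk f g) (mk (f ≫ k) (g ≫ k)) :=
      Zigzag.of_hom (StructuredArrow.homMk k rfl)
    have moveLeft (f f' : a ⟶ zero) (g : b ⟶ zero) : Zigzag (mk f g) (mk f' g) := by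
      obtain ⟨h, hh⟩ := exists_lift_or_lift_symm f f'
      -- The reflexion is a section of both `left` and `right`, so the second leg returns to `g` on
      -- either side while the first becomes `f` or `f'`.
      have h1 := step Hom.left h (g ≫ Hom.reflexion)
      have h2 := step Hom.right h (g ≫ Hom.reflexion)
      simp only [Category.assoc, reflexion_comp_left, reflexion_comp_right,
        Category.comp_id] at h1 h2
      obtain ⟨e1, e2⟩ | ⟨e1, e2⟩ := hh
      · rw [e1] at h1; rw [e2] at h2
        exact h1.symm.trans h2
      · rw [e1] at h1; rw [e2] at h2
        exact h2.symm.trans h1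
    have moveRight (f : a ⟶ zero) (g g' : b ⟶ zero) : Zigzag (mk f g) (mk f g') := by
      obtain ⟨h, hh⟩ := exists_lift_or_lift_symm g g'
      have h1 := step Hom.left (f ≫ Hom.reflexion) h
      have h2 := step Hom.right (f ≫ Hom.reflexion) h
      simp only [Category.assoc, reflexion_comp_left, reflexion_comp_right,
        Category.comp_id] at h1 h2
      obtain ⟨e1, e2⟩ | ⟨e1, e2⟩ := hh
      · rw [e1] at h1; rw [e2] at h2
        exact h1.symm.trans h2
      · rw [e1] at h1; rw [e2] at h2
        exact h2.symm.trans h1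
    obtain ⟨f₀⟩ := exists_hom_zero a
    obtain ⟨g₀⟩ := exists_hom_zero b
    have key (x : StructuredArrow (a, b) (Functor.diag WalkingReflexivePair)) :
        Zigzag x (mk f₀ g₀) := by
      obtain ⟨k⟩ := exists_hom_zero x.right
      exact (step k x.hom.1 x.hom.2).trans ((moveLeft _ f₀ _).trans (moveRight _ _ g₀))
    have : Nonempty (StructuredArrow (a, b) (Functor.diag WalkingReflexivePair)) := ⟨mk f₀ g₀⟩
    exact zigzag_isConnected fun x y => (key x).trans (key y).symm

end CategoryTheory.Limits.WalkingReflexivePair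

/-! ### Sifted colimits of precategories, computed pointwise. -/

namespace CoSegal

/-- Closedness and symmetry make tensoring on either side a left adjoint. This is the input for
tensoring colimit cocones over a sifted shape. -/
instance preservesColimit₂_curriedTensor {M : Type u} [Category.{v} M] [MonoidalCategory M]
    [SymmetricCategory M] [MonoidalClosed M] {K : Type*} [Category* K] {F G : K ⥤ M} :
    PreservesColimit₂ F G (curriedTensor M) := by
  have (Y : M) : PreservesColimit F ((curriedTensor M).flip.obj Y) :=
    inferInstanceAs (PreservesColimit F (tensorRight Y))
  have (Y : M) : PreservesColimit G ((curriedTensor M).obj Y) :=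
    inferInstanceAs (PreservesColimit G (tensorLeft Y))
  infer_instance

namespace Precat

section Basic

variable {M : Type u} [Category.{v} M] [MonoidalCategory M] {X : Type w}

variable (M) in
/-- The functor that takes a precategory to one of its components. -/
@[simps]
def diagFunctor (A B : X) : Precat M X ⥤ (Chain A B ⥤ M) where
  obj F := F.diag A B
  map f := f.app A B

/-- A morphism of precategories is an isomorphism if all its components are. -/
theorem isIso_of_isIso_app {F G : Precat M X} (f : F ⟶ G)
    [h : ∀ (A B : X) (s : Chain A B), IsIso ((f.app A B).app s)] : IsIso f := by
  have h' (A B : X) : IsIso (f.app A B) := NatIso.isIso_of_isIso_app _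
  let g : Hom G F :=
    { app A B := inv (f.app A B)
      lax_comm {A B C} s t := by
        rw [NatIso.isIso_inv_app, NatIso.isIso_inv_app, NatIso.isIso_inv_app, IsIso.comp_inv_eq,
          Category.assoc, f.lax_comm, tensorHom_comp_tensorHom_assoc]
        simp }
  refine ⟨g, ?_, ?_⟩
  · apply Hom.ext; funext A B; exact IsIso.hom_inv_id (f.app A B)
  · apply Hom.ext; funext A B; exact IsIso.inv_hom_id (f.app A B)

end Basic

variable {M : Type u} [Category.{v} M] [MonoidalCategory M] {X : Type w}
  {K : Type*} [Category* K] [HasColimitsOfShape K M] (D : K ⥤ Precat M X)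

namespace SiftedColimit

/-- The components of the colimit of a diagram of precategories. -/
noncomputable def diag (A B : X) : Chain A B ⥤ M := colimit (D ⋙ diagFunctor M A B)

/-- The components of the colimit cocone. -/
noncomputable def ι (k : K) (A B : X) : (D.obj k).diag A B ⟶ diag D A B :=
  colimit.ι (D ⋙ diagFunctor M A B) k

theorem map_ι {k k' : K} (f : k ⟶ k') (A B : X) : (D.map f).app A B ≫ ι D k' A B = ι D k A B :=
  colimit.w (D ⋙ diagFunctor M A B) f

/-- This is the cocone condition from which the laxity maps of the colimit are induced. -/
theorem lax_ι_naturality {k k' : K} (f : k ⟶ k') {A B C : X} (s : Chain A B) (t : Chain B C) :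
    (((D.map f).app A B).app s ⊗ₘ ((D.map f).app B C).app t) ≫
        (D.obj k').lax s t ≫ (ι D k' A C).app (s.concat t) =
      (D.obj k).lax s t ≫ (ι D k A C).app (s.concat t) := by
  have h2 := congr_app (map_ι D f A C) (s.concat t)
  simp only [NatTrans.comp_app] at h2
  rw [← reassoc_of% (D.map f).lax_comm s t, h2]

/-- The values of the colimit cocone at a chain. -/
@[simps]
noncomputable def evCocone {A B : X} (s : Chain A B) : Cocone (D ⋙ ev M s) where
  pt := (diag D A B).obj s
  ι :=
    { app k := (ι D k A B).app s
      naturality k k' f := by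
        have := congr_app (map_ι D f A B) s
        simpa [ev] using this }

/-- The colimit is computed pointwise. -/
noncomputable def isColimitEvCocone {A B : X} (s : Chain A B) : IsColimit (evCocone D s) :=
  isColimitOfPreserves ((evaluation _ _).obj s) (colimit.isColimit (D ⋙ diagFunctor M A B))

/-- The components of the morphism from the colimit to another cocone. -/
noncomputable def descApp (c : Cocone D) (A B : X) : diag D A B ⟶ c.pt.diag A B :=
  colimit.desc _ ((diagFunctor M A B).mapCocone c)

theorem ι_descApp (c : Cocone D) (k : K) {A B : X} (s : Chain A B) :
    (ι D k A B).app s ≫ (descApp D c A B).app s = ((c.ι.app k).app A B).app s :=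
  congr_app (colimit.ι_desc ((diagFunctor M A B).mapCocone c) k) s

variable [SymmetricCategory M] [MonoidalClosed M] [IsSifted K]

/-- The tensor product of two values of the colimit is the colimit of the tensor products. -/
noncomputable def isColimitTensor {A B C : X} (s : Chain A B) (t : Chain B C) :
    IsColimit ((evCocone D s).tensor (evCocone D t)) :=
  (isColimitEvCocone D s).tensor (isColimitEvCocone D t)

/-- Siftedness lets one test on the diagonal only, with the same index `k` in both factors; all
identities in the colimit thereby reduce to identities in a single `D.obj k`. -/
theorem tensor_hom_ext {A B C : X} {s : Chain A B} {t : Chain B C} {Z : M}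
    {f g : (diag D A B).obj s ⊗ (diag D B C).obj t ⟶ Z}
    (h : ∀ k, ((ι D k A B).app s ⊗ₘ (ι D k B C).app t) ≫ f =
      ((ι D k A B).app s ⊗ₘ (ι D k B C).app t) ≫ g) : f = g :=
  (isColimitTensor D s t).hom_ext h

theorem tensor_hom_ext₃ {A B C E : X} {r : Chain A B} {s : Chain B C} {t : Chain C E} {Z : M}
    {f g : ((diag D A B).obj r ⊗ (diag D B C).obj s) ⊗ (diag D C E).obj t ⟶ Z}
    (h : ∀ k, (((ι D k A B).app r ⊗ₘ (ι D k B C).app s) ⊗ₘ (ι D k C E).app t) ≫ f =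
      (((ι D k A B).app r ⊗ₘ (ι D k B C).app s) ⊗ₘ (ι D k C E).app t) ≫ g) : f = g :=
  ((isColimitTensor D r s).tensor (isColimitEvCocone D t)).hom_ext h

/-- The laxity maps of the colimit. -/
noncomputable def lax {A B C : X} (s : Chain A B) (t : Chain B C) :
    (diag D A B).obj s ⊗ (diag D B C).obj t ⟶ (diag D A C).obj (s.concat t) :=
  (isColimitTensor D s t).desc
    { pt := (diag D A C).obj (s.concat t)
      ι :=
        { app k := (D.obj k).lax s t ≫ (ι D k A C).app (s.concat t)
          naturality k k' f := by
            exact (lax_ι_naturality D f s t).trans (Category.comp_id _).symm } }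

theorem ι_lax (k : K) {A B C : X} (s : Chain A B) (t : Chain B C) :
    ((ι D k A B).app s ⊗ₘ (ι D k B C).app t) ≫ lax D s t =
      (D.obj k).lax s t ≫ (ι D k A C).app (s.concat t) :=
  (isColimitTensor D s t).fac _ k

/-- The colimit of a diagram of precategories. -/
noncomputable def pt : Precat M X where
  diag := diag D
  lax := lax D
  lax_naturality {A B C s s' t t'} f g := by
    apply tensor_hom_ext
    intro k
    rw [reassoc_of% (ι_lax D k s t), tensorHom_comp_tensorHom_assoc, ← NatTrans.naturality,
      ← NatTrans.naturality, ← NatTrans.naturality, ← tensorHom_comp_tensorHom_assoc, ι_lax]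
    rw [reassoc_of% (D.obj k).lax_naturality f g]
  lax_assoc {A B C E} r s t := by
    apply tensor_hom_ext₃
    intro k
    have h := (D.obj k).lax_assoc r s t
    -- `e1` and `e2` move the cocone legs past the inner laxity map on each side, after which the
    -- associativity of `D.obj k` applies.
    have e1 : (((ι D k A B).app r ⊗ₘ (ι D k B C).app s) ⊗ₘ (ι D k C E).app t) ≫
        lax D r s ▷ (diag D C E).obj t =
        ((D.obj k).lax r s ▷ _) ≫ ((ι D k A C).app (r.concat s) ⊗ₘ (ι D k C E).app t) := by
      rw [← tensorHom_id, tensorHom_comp_tensorHom, ι_lax, Category.comp_id,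
        ← tensorHom_id, tensorHom_comp_tensorHom, Category.id_comp]
    have e2 : ((ι D k A B).app r ⊗ₘ ((ι D k B C).app s ⊗ₘ (ι D k C E).app t)) ≫
        (diag D A B).obj r ◁ lax D s t =
        (_ ◁ (D.obj k).lax s t) ≫ ((ι D k A B).app r ⊗ₘ (ι D k B E).app (s.concat t)) := by
      rw [← id_tensorHom, tensorHom_comp_tensorHom, ι_lax, Category.comp_id,
        ← id_tensorHom, tensorHom_comp_tensorHom, Category.id_comp]
    rw [reassoc_of% e1, reassoc_of% (ι_lax D k (r.concat s) t), ← NatTrans.naturality,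
      associator_naturality_assoc,
      reassoc_of% e2, ι_lax, reassoc_of% h]

/-- The colimit cocone of a diagram of precategories. -/
noncomputable def cocone : Cocone D where
  pt := pt D
  ι :=
    { app k :=
        ({ app A B := ι D k A B
           lax_comm s t := (ι_lax D k s t).symm } : Hom (D.obj k) (pt D))
      naturality k k' f := by
        apply Hom.ext
        funext A B
        exact (map_ι D f A B).trans (Category.comp_id _).symm }

theorem lax_descApp (c : Cocone D) {A B C : X} (s : Chain A B) (t : Chain B C) :
    lax D s t ≫ (descApp D c A C).app (s.concat t) =
      ((descApp D c A B).app s ⊗ₘ (descApp D c B C).app t) ≫ c.pt.lax s t := by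
  apply tensor_hom_ext
  intro k
  rw [reassoc_of% (ι_lax D k s t), ι_descApp, tensorHom_comp_tensorHom_assoc, ι_descApp, ι_descApp]
  exact (c.ι.app k).lax_comm s t

/-- The colimit cocone of a diagram of precategories is a colimit. -/
noncomputable def isColimit : IsColimit (cocone D) where
  desc c :=
    ({ app A B := descApp D c A B
       lax_comm {A B C} s t := by
        exact lax_descApp D c s t } : Hom (pt D) c.pt)
  fac c k := by
    apply Hom.ext
    funext A B
    exact colimit.ι_desc ((diagFunctor M A B).mapCocone c) k
  uniq c m hm := by
    apply Hom.ext
    funext A B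
    apply colimit.hom_ext
    intro k
    exact (congrArg (fun f => Hom.app f A B) (hm k)).trans
      (colimit.ι_desc ((diagFunctor M A B).mapCocone c) k).symm

end SiftedColimit

variable [SymmetricCategory M] [MonoidalClosed M] [IsSifted K]

instance hasColimitsOfShape_of_isSifted : HasColimitsOfShape K (Precat M X) where
  has_colimit D := ⟨⟨⟨_, SiftedColimit.isColimit D⟩⟩⟩

instance preservesColimitsOfShape_ev {A B : X} (s : Chain A B) :
    PreservesColimitsOfShape K (ev M s) where
  preservesColimit {D} := preservesColimit_of_preserves_colimit_cocone
    (SiftedColimit.isColimit D) (SiftedColimit.isColimitEvCocone D s)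

end Precat
end CoSegal

namespace CoSegal

/-! ### Tensor products of jointly epic families -/

section JointlyEpic

variable {M : Type u} [Category.{v} M]

/-- A family of morphisms with a common target is jointly epic. -/
def JointlyEpic {I : Type*} {Y : I → M} {Z : M} (e : ∀ i, Y i ⟶ Z) : Prop :=
  ∀ ⦃W : M⦄ (f g : Z ⟶ W), (∀ i, e i ≫ f = e i ≫ g) → f = g

theorem jointlyEpic_sigma_ι {I : Type*} (Y : I → M) [HasCoproduct Y] : JointlyEpic (Sigma.ι Y) :=
  fun _ _ _ h => Sigma.hom_ext _ _ h

variable [MonoidalCategory M] [MonoidalClosed M]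

/-- Currying turns maps out of `V ⊗ Z` into maps out of `Z`, naturally in `Z`. -/
theorem JointlyEpic.whiskerLeft {I : Type*} {Y : I → M} {Z : M} {e : ∀ i, Y i ⟶ Z}
    (h : JointlyEpic e) (V : M) : JointlyEpic fun i => V ◁ e i := by
  intro W f g hfg
  apply MonoidalClosed.curry_injective
  apply h
  intro i
  rw [← MonoidalClosed.curry_natural_left, ← MonoidalClosed.curry_natural_left, hfg]

variable [SymmetricCategory M]

theorem JointlyEpic.whiskerRight {I : Type*} {Y : I → M} {Z : M} {e : ∀ i, Y i ⟶ Z}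
    (h : JointlyEpic e) (V : M) : JointlyEpic fun i => e i ▷ V := by
  intro W f g hfg
  rw [← cancel_epi (β_ V Z).hom]
  apply h.whiskerLeft V
  intro i
  simp [hfg i]

theorem JointlyEpic.tensorHom {I J : Type*} {Y : I → M} {Z : M} {e : ∀ i, Y i ⟶ Z}
    {Y' : J → M} {Z' : M} {e' : ∀ j, Y' j ⟶ Z'} (h : JointlyEpic e) (h' : JointlyEpic e') :
    JointlyEpic fun i : I × J => e i.1 ⊗ₘ e' i.2 := by
  intro W f g hfg
  apply h.whiskerRight
  intro i
  apply h'.whiskerLeft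
  intro j
  simpa [MonoidalCategory.tensorHom_def'] using hfg (i, j)

/-- The morphism from a tensor product of two coproducts with given components. -/
noncomputable def tensorSigmaDesc {I J : Type*} {Y : I → M} {Z : J → M} [HasCoproduct Y]
    [HasCoproduct Z] {W : M} (f : ∀ i j, Y i ⊗ Z j ⟶ W) : (∐ Y) ⊗ (∐ Z) ⟶ W :=
  MonoidalClosed.uncurry (Sigma.desc fun j => MonoidalClosed.curry
    ((β_ _ _).hom ≫ MonoidalClosed.uncurry (Sigma.desc fun i => MonoidalClosed.curry
      ((β_ _ _).hom ≫ f i j))))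

@[simp]
theorem ι_tensorSigmaDesc {I J : Type*} {Y : I → M} {Z : J → M} [HasCoproduct Y]
    [HasCoproduct Z] {W : M} (f : ∀ i j, Y i ⊗ Z j ⟶ W) (i : I) (j : J) :
    (Sigma.ι Y i ⊗ₘ Sigma.ι Z j) ≫ tensorSigmaDesc f = f i j := by
  rw [MonoidalCategory.tensorHom_def, Category.assoc, tensorSigmaDesc,
    ← MonoidalClosed.uncurry_natural_left, Sigma.ι_desc, MonoidalClosed.uncurry_curry,
    BraidedCategory.braiding_naturality_left_assoc, ← MonoidalClosed.uncurry_natural_left,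
    Sigma.ι_desc, MonoidalClosed.uncurry_curry]
  simp

end JointlyEpic

/-! ### Concatenation of insertions -/

namespace Ins

variable {X : Type w}

theorem append_comp {l₁ l₁' l₁'' l₂ l₂' l₂'' : List X} (f : Ins l₁ l₁') (f' : Ins l₁' l₁'')
    (g : Ins l₂ l₂') (g' : Ins l₂' l₂'') :
    append (comp f f') (comp g g') = comp (append f g) (append f' g') := by
  induction f' generalizing l₁ with
  | nil => cases f; simp only [comp, append]
  | insert a f' ih => simp only [comp, append, ih]
  | keep a f' ih =>
    cases f with
    | insert _ f => simp only [comp, append, ih]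
    | keep _ f => simp only [comp, append, ih]

theorem append_id (l₁ l₂ : List X) : append (id l₁) (id l₂) = id (l₁ ++ l₂) := by
  induction l₁ with
  | nil => rfl
  | cons a l ih => exact congrArg (keep a) ih

/-- Rebracketing a triple juxtaposition changes its source and target words by an equality that is
only propositional, hence the heterogeneous form. -/
theorem keep_heq (a : X) {l l' m m' : List X} (h : l = m) (h' : l' = m') {f : Ins l l'}
    {g : Ins m m'} (hfg : f ≍ g) : keep a f ≍ keep a g := by
  subst h h'; rw [eq_of_heq hfg]

theorem insert_heq (a : X) {l l' m m' : List X} (h : l = m) (h' : l' = m') {f : Ins l l'}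
    {g : Ins m m'} (hfg : f ≍ g) : insert a f ≍ insert a g := by
  subst h h'; rw [eq_of_heq hfg]

theorem append_assoc {l₁ l₁' l₂ l₂' l₃ l₃' : List X} (f : Ins l₁ l₁') (g : Ins l₂ l₂')
    (h : Ins l₃ l₃') : append (append f g) h ≍ append f (append g h) := by
  induction f with
  | nil => rfl
  | keep a f ih => exact keep_heq a (by simp) (by simp) ih
  | insert a f ih => exact insert_heq a (by simp) (by simp) ih

end Ins

namespace Chain

variable {X : Type w}

theorem concatMap_id {A B C : X} (s : Chain A B) (t : Chain B C) :
    concatMap (𝟙 s) (𝟙 t) = 𝟙 (s.concat t) :=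
  Ins.append_id s.mid (B :: t.mid)

theorem concatMap_comp {A B C : X} {s s' s'' : Chain A B} {t t' t'' : Chain B C} (f : s ⟶ s')
    (f' : s' ⟶ s'') (g : t ⟶ t') (g' : t' ⟶ t'') :
    concatMap (f ≫ f') (g ≫ g') = concatMap f g ≫ concatMap f' g' :=
  Ins.append_comp (l₁ := s.mid) (l₁' := s'.mid) (l₁'' := s''.mid) f f'
    (Ins.keep B (l := t.mid) (l' := t'.mid) g)
    (Ins.keep B (l := t'.mid) (l' := t''.mid) g')

theorem concatMap_assoc {A B C D : X} {r r' : Chain A B} {s s' : Chain B C} {t t' : Chain C D}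
    (f : r ⟶ r') (g : s ⟶ s') (h : t ⟶ t') :
    concatMap (concatMap f g) h ≫ eqToHom (concat_assoc r' s' t') =
      eqToHom (concat_assoc r s t) ≫ concatMap f (concatMap g h) := by
  have key : concatMap (concatMap f g) h ≍ concatMap f (concatMap g h) :=
    Ins.append_assoc (l₁ := r.mid) (l₁' := r'.mid) f
      (Ins.keep B (l := s.mid) (l' := s'.mid) g) (Ins.keep C (l := t.mid) (l' := t'.mid) h)
  rw [← (conj_eqToHom_iff_heq _ _ (concat_assoc r s t) (concat_assoc r' s' t')).2 key |>.symm]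
  simp

theorem concatMap_eqToHom_left {A B C : X} {s s' s'' : Chain A B} {t t' : Chain B C} (h : s = s')
    (f : s' ⟶ s'') (g : t ⟶ t') :
    concatMap (eqToHom h ≫ f) g = eqToHom (by rw [h]) ≫ concatMap f g := by
  subst h; simp

theorem concatMap_eqToHom_right {A B C : X} {s s' : Chain A B} {t t' t'' : Chain B C} (h : t = t')
    (f : s ⟶ s') (g : t' ⟶ t'') :
    concatMap f (eqToHom h ≫ g) = eqToHom (by rw [h]) ≫ concatMap f g := by
  subst h; simp

end Chain

/-! ### Paths of chains -/

/-- A non-empty sequence of composable chains. -/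
inductive ChainPath {X : Type w} : X → X → Type w
  | single {A B : X} (s : Chain A B) : ChainPath A B
  | cons {A B C : X} (s : Chain A B) (p : ChainPath B C) : ChainPath A C

namespace ChainPath

variable {X : Type w}

/-- The concatenation of the members of a path. -/
def total {A B : X} : ChainPath A B → Chain A B
  | single s => s
  | cons s p => s.concat p.total

/-- Juxtaposition of paths. -/
def append {A B C : X} : ChainPath A B → ChainPath B C → ChainPath A C
  | single s, q => cons s q
  | cons s p, q => cons s (p.append q)

theorem total_append {A B C : X} (p : ChainPath A B) (q : ChainPath B C) :
    (p.append q).total = p.total.concat q.total := by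
  induction p with
  | single s => rfl
  | cons s p ih => rw [append, total, ih, total, Chain.concat_assoc]

theorem append_assoc {A B C D : X} (p : ChainPath A B) (q : ChainPath B C) (r : ChainPath C D) :
    (p.append q).append r = p.append (q.append r) := by
  induction p with
  | single s => rfl
  | cons s p ih => rw [append, append, ih, append]

variable {M : Type u} [Category.{v} M] [MonoidalCategory M] (k : ∀ A B : X, Chain A B → M)

/-- The tensor product of a family of objects along a path. -/
def tensor {A B : X} : ChainPath A B → M
  | single s => k _ _ s
  | cons s p => k _ _ s ⊗ p.tensor

/-- The associativity isomorphism for tensor products along paths. -/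
def tensorAppend {A B C : X} : (p : ChainPath A B) → (q : ChainPath B C) →
    (p.tensor k ⊗ q.tensor k ⟶ (p.append q).tensor k)
  | single s, q => 𝟙 (k _ _ s ⊗ q.tensor k)
  | cons s p, q => (α_ (k _ _ s) (p.tensor k) (q.tensor k)).hom ≫ k _ _ s ◁ p.tensorAppend q

theorem whiskerLeft_eqToHom_tensor {A B C : X} (s : Chain A B) {p q : ChainPath B C} (h : p = q) :
    k _ _ s ◁ eqToHom (congrArg (fun p => p.tensor k) h) =
      eqToHom (congrArg (fun p => (cons s p).tensor k) h) := by
  subst h; exact MonoidalCategory.whiskerLeft_id _ _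

/-- The induction step of `tensorAppend_assoc`, stated for arbitrary objects so that the pentagon is
used without dependent indices in the way; `e` stands for the transport along associativity of
juxtaposition. -/
theorem whiskerLeft_pentagon {P Q R PQ QR W W' : M} (S : M) {f : P ⊗ Q ⟶ PQ} {g : PQ ⊗ R ⟶ W}
    {e : W ⟶ W'} {f' : Q ⊗ R ⟶ QR} {g' : P ⊗ QR ⟶ W'}
    (h : (f ▷ R) ≫ g ≫ e = (α_ _ _ _).hom ≫ (P ◁ f') ≫ g') :
    (((α_ S P Q).hom ≫ S ◁ f) ▷ R) ≫ ((α_ S PQ R).hom ≫ S ◁ g) ≫ S ◁ e =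
      (α_ (S ⊗ P) Q R).hom ≫ ((S ⊗ P) ◁ f') ≫ (α_ S P QR).hom ≫ S ◁ g' := by
  replace h := congrArg (fun f => S ◁ f) h
  simp only [MonoidalCategory.whiskerLeft_comp] at h
  simp [h]

theorem tensorAppend_assoc {A B C D : X} (p : ChainPath A B) (q : ChainPath B C)
    (r : ChainPath C D) :
    (p.tensorAppend k q ▷ r.tensor k) ≫ (p.append q).tensorAppend k r ≫
        eqToHom (congrArg (fun p => p.tensor k) (append_assoc p q r)) =
      (α_ _ _ _).hom ≫ (p.tensor k ◁ q.tensorAppend k r) ≫ p.tensorAppend k (q.append r) := by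
  induction p with
  | @single A B s =>
    change (𝟙 (k _ _ s ⊗ q.tensor k) ▷ r.tensor k) ≫ ((α_ (k _ _ s) (q.tensor k) (r.tensor k)).hom ≫
      k _ _ s ◁ q.tensorAppend k r) ≫ 𝟙 _ = (α_ (k _ _ s) (q.tensor k) (r.tensor k)).hom ≫
        k _ _ s ◁ q.tensorAppend k r ≫ 𝟙 _
    simp
  | cons s p ih =>
    exact (congrArg (fun e => _ ≫ _ ≫ e)
      (whiskerLeft_eqToHom_tensor k s (append_assoc p q r)).symm).trans
        (whiskerLeft_pentagon (k _ _ s) (ih q))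

end ChainPath

end CoSegal

namespace CoSegal

/-! ### Free precategories -/

namespace Free

variable {M : Type u} [Category.{v} M] [MonoidalCategory M] {X : Type w} [HasCoproducts.{w} M]
  (k : ∀ A B : X, Chain A B → M)

/-- The summands of the value of a free precategory at a chain. -/
abbrev Index {A B : X} (t : Chain A B) : Type w := Σ p : ChainPath A B, (p.total ⟶ t)

/-- The value of a free precategory at a chain. -/
noncomputable def obj {A B : X} (t : Chain A B) : M := ∐ fun i : Index t => i.1.tensor k

/-- The inclusions of the summands. -/
noncomputable def ι {A B : X} {t : Chain A B} (p : ChainPath A B) (σ : p.total ⟶ t) :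
    p.tensor k ⟶ obj k t :=
  Sigma.ι (fun i : Index t => i.1.tensor k) ⟨p, σ⟩

/-- The summands of a free precategory, as a family. -/
noncomputable abbrev inc {A B : X} (t : Chain A B) (i : Index t) : i.1.tensor k ⟶ obj k t :=
  ι k i.1 i.2

theorem jointlyEpic_inc {A B : X} (t : Chain A B) : JointlyEpic (inc k t) :=
  jointlyEpic_sigma_ι _

/-- Summands are indexed by paths, and the two bracketings of a triple juxtaposition give equal but
not definitionally equal indices; this transports between them. -/
theorem ι_congr {A B : X} {t : Chain A B} {p q : ChainPath A B} (h : p = q) {σ : p.total ⟶ t}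
    {τ : q.total ⟶ t} (h' : σ = eqToHom (congrArg ChainPath.total h) ≫ τ) :
    eqToHom (congrArg (fun p => p.tensor k) h) ≫ ι k q τ = ι k p σ := by
  subst h; subst h'; simp

/-- The morphism from the value of a free precategory with given components. -/
noncomputable def desc {A B : X} {t : Chain A B} {W : M}
    (f : ∀ (p : ChainPath A B) (_ : p.total ⟶ t), p.tensor k ⟶ W) : obj k t ⟶ W :=
  Sigma.desc fun i => f i.1 i.2

@[simp]
theorem ι_desc {A B : X} {t : Chain A B} {W : M}
    (f : ∀ (p : ChainPath A B) (_ : p.total ⟶ t), p.tensor k ⟶ W) (p : ChainPath A B)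
    (σ : p.total ⟶ t) : ι k p σ ≫ desc k f = f p σ :=
  Sigma.ι_desc (fun i : Index t => f i.1 i.2) ⟨p, σ⟩

theorem hom_ext {A B : X} {t : Chain A B} {W : M} {f g : obj k t ⟶ W}
    (h : ∀ (p : ChainPath A B) (σ : p.total ⟶ t), ι k p σ ≫ f = ι k p σ ≫ g) : f = g :=
  jointlyEpic_inc k t _ _ fun i => h i.1 i.2

/-- The functoriality of a free precategory in the chain. -/
noncomputable def map {A B : X} {t t' : Chain A B} (f : t ⟶ t') : obj k t ⟶ obj k t' :=
  desc k fun p σ => ι k p (σ ≫ f)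

@[simp]
theorem ι_map {A B : X} {t t' : Chain A B} (p : ChainPath A B) (σ : p.total ⟶ t) (f : t ⟶ t') :
    ι k p σ ≫ map k f = ι k p (σ ≫ f) :=
  ι_desc k _ p σ

/-- The components of a free precategory. -/
noncomputable def diag (A B : X) : Chain A B ⥤ M where
  obj t := obj k t
  map f := map k f
  map_id t := hom_ext k fun p σ => by simp
  map_comp f g := hom_ext k fun p σ => by rw [reassoc_of% (ι_map k p σ f)]; simp

/-- The morphism of chains that indexes a product of summands. -/
def concatIndex {A B C : X} {s : Chain A B} {t : Chain B C} {p : ChainPath A B}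
    {q : ChainPath B C} (σ : p.total ⟶ s) (τ : q.total ⟶ t) : (p.append q).total ⟶ s.concat t :=
  eqToHom (p.total_append q) ≫ Chain.concatMap σ τ

theorem concatIndex_comp {A B C : X} {s s' : Chain A B} {t t' : Chain B C} {p : ChainPath A B}
    {q : ChainPath B C} (σ : p.total ⟶ s) (τ : q.total ⟶ t) (f : s ⟶ s') (g : t ⟶ t') :
    concatIndex (σ ≫ f) (τ ≫ g) = concatIndex σ τ ≫ Chain.concatMap f g := by
  rw [concatIndex, concatIndex, Chain.concatMap_comp, Category.assoc]

theorem concatIndex_assoc {A B C D : X} {r : Chain A B} {s : Chain B C} {t : Chain C D}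
    {p : ChainPath A B} {q : ChainPath B C} {o : ChainPath C D} (ρ : p.total ⟶ r) (σ : q.total ⟶ s)
    (τ : o.total ⟶ t) :
    concatIndex (concatIndex ρ σ) τ ≫ eqToHom (Chain.concat_assoc r s t) =
      eqToHom (congrArg ChainPath.total (p.append_assoc q o)) ≫
        concatIndex ρ (concatIndex σ τ) := by
  simp only [concatIndex, Chain.concatMap_eqToHom_left, Chain.concatMap_eqToHom_right,
    Category.assoc, Chain.concatMap_assoc, eqToHom_trans_assoc]

variable [SymmetricCategory M] [MonoidalClosed M]

/-- The laxity maps of a free precategory. -/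
noncomputable def lax {A B C : X} (s : Chain A B) (t : Chain B C) :
    obj k s ⊗ obj k t ⟶ obj k (s.concat t) :=
  tensorSigmaDesc fun i j => i.1.tensorAppend k j.1 ≫ ι k _ (concatIndex i.2 j.2)

theorem ι_lax {A B C : X} {s : Chain A B} {t : Chain B C} (p : ChainPath A B) (σ : p.total ⟶ s)
    (q : ChainPath B C) (τ : q.total ⟶ t) :
    (ι k p σ ⊗ₘ ι k q τ) ≫ lax k s t = p.tensorAppend k q ≫ ι k _ (concatIndex σ τ) :=
  ι_tensorSigmaDesc (Y := fun i : Index s => i.1.tensor k) (Z := fun i : Index t => i.1.tensor k)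
    _ ⟨p, σ⟩ ⟨q, τ⟩

theorem lax_naturality {A B C : X} {s s' : Chain A B} {t t' : Chain B C} (f : s ⟶ s')
    (g : t ⟶ t') :
    (map k f ⊗ₘ map k g) ≫ lax k s' t' =
      lax k s t ≫ map k (Chain.concatMap f g) := by
  apply (jointlyEpic_inc k s).tensorHom (jointlyEpic_inc k t)
  rintro ⟨⟨p, σ⟩, ⟨q, τ⟩⟩
  dsimp only [inc]
  rw [reassoc_of% (ι_lax k p σ q τ), ι_map, tensorHom_comp_tensorHom_assoc, ι_map, ι_map, ι_lax,
    concatIndex_comp]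

/-- Testing on triples of summands splits the claim into coherence of the tensor products
(`ChainPath.tensorAppend_assoc`) and equality of the indexing morphisms (`concatIndex_assoc`). -/
theorem lax_assoc {A B C D : X} (r : Chain A B) (s : Chain B C) (t : Chain C D) :
    (lax k r s ▷ obj k t) ≫ lax k (r.concat s) t ≫
        map k (eqToHom (Chain.concat_assoc r s t)) =
      (α_ _ _ _).hom ≫ (obj k r ◁ lax k s t) ≫ lax k r (s.concat t) := by
  apply ((jointlyEpic_inc k r).tensorHom (jointlyEpic_inc k s)).tensorHom (jointlyEpic_inc k t)
  rintro ⟨⟨⟨p, ρ⟩, ⟨q, σ⟩⟩, ⟨o, τ⟩⟩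
  have e1 : ((ι k p ρ ⊗ₘ ι k q σ) ⊗ₘ ι k o τ) ≫ lax k r s ▷ obj k t =
      (p.tensorAppend k q ▷ _) ≫ (ι k _ (concatIndex ρ σ) ⊗ₘ ι k o τ) := by
    rw [← tensorHom_id, tensorHom_comp_tensorHom, ι_lax, Category.comp_id,
      ← tensorHom_id, tensorHom_comp_tensorHom, Category.id_comp]
  have e2 : (ι k p ρ ⊗ₘ (ι k q σ ⊗ₘ ι k o τ)) ≫ obj k r ◁ lax k s t =
      (_ ◁ q.tensorAppend k o) ≫ (ι k p ρ ⊗ₘ ι k _ (concatIndex σ τ)) := by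
    rw [← id_tensorHom, tensorHom_comp_tensorHom, ι_lax, Category.comp_id,
      ← id_tensorHom, tensorHom_comp_tensorHom, Category.id_comp]
  dsimp only [inc]
  rw [reassoc_of% e1, reassoc_of% (ι_lax k _ (concatIndex ρ σ) o τ), ι_map,
    associator_naturality_assoc, reassoc_of% e2, ι_lax,
    ← ι_congr k (p.append_assoc q o) (concatIndex_assoc ρ σ τ)]
  exact (reassoc_of% (ChainPath.tensorAppend_assoc k p q o)) _

/-- The free precategory generated by a family of objects indexed by the chains. -/
noncomputable def precat : Precat M X where
  diag := diag k
  lax s t := lax k s t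
  lax_naturality f g := lax_naturality k f g
  lax_assoc r s t := lax_assoc k r s t

section Lift

variable {k} {G : Precat M X} (φ : ∀ (A B : X) (s : Chain A B), k A B s ⟶ (G.diag A B).obj s)

omit [HasCoproducts.{w} M] [SymmetricCategory M] [MonoidalClosed M] in
theorem lax_eqToHom {A B C : X} (s : Chain A B) {t t' : Chain B C} (h : t = t') :
    G.lax s t ≫ (G.diag A C).map (eqToHom (congrArg s.concat h)) =
      ((G.diag A B).obj s ◁ (G.diag B C).map (eqToHom h)) ≫ G.lax s t' := by
  subst h; simp

/-- The morphism from a tensor product along a path that a family of morphisms determines. -/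
noncomputable def pathMap {A B : X} :
    (p : ChainPath A B) → (p.tensor k ⟶ (G.diag A B).obj p.total)
  | .single s => φ _ _ s
  | .cons s p => (φ _ _ s ⊗ₘ pathMap p) ≫ G.lax s p.total

omit [HasCoproducts.{w} M] [SymmetricCategory M] [MonoidalClosed M] in
-- The induction step of `pathMap_append` with abstract objects: `h` is the induction hypothesis,
-- `h₁` associativity of the laxity maps of `G`, and `h₂` their compatibility with transport in the
-- second chain.
theorem pathMap_append_aux {S P Q PQ S' P' Q' T U V W Z : M} {φ : S ⟶ S'} {μ : P ⊗ Q ⟶ PQ}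
    {e : PQ ⟶ U} {e₁ : P ⟶ P'} {e₂ : Q ⟶ Q'} {m : U ⟶ V} {l : P' ⊗ Q' ⟶ V} {l' : S' ⊗ U ⟶ T}
    {c : T ⟶ W} {n : S' ⊗ V ⟶ W} {i : S' ⊗ P' ⟶ Z} {j : Z ⊗ Q' ⟶ W}
    (h : μ ≫ e ≫ m = (e₁ ⊗ₘ e₂) ≫ l) (h₁ : (i ▷ Q') ≫ j = (α_ _ _ _).hom ≫ (S' ◁ l) ≫ n)
    (h₂ : l' ≫ c = (S' ◁ m) ≫ n) :
    ((α_ S P Q).hom ≫ S ◁ μ) ≫ ((φ ⊗ₘ e) ≫ l') ≫ c = (((φ ⊗ₘ e₁) ≫ i) ⊗ₘ e₂) ≫ j := by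
  have e1 : (((φ ⊗ₘ e₁) ≫ i) ⊗ₘ e₂) ≫ j = ((φ ⊗ₘ e₁) ⊗ₘ e₂) ≫ (i ▷ Q') ≫ j := by
    rw [← tensorHom_id, tensorHom_comp_tensorHom_assoc, Category.comp_id]
  rw [e1, h₁, associator_naturality_assoc, ← id_tensorHom S' l, tensorHom_comp_tensorHom_assoc,
    ← h]
  simp only [Category.assoc, h₂, MonoidalCategory.tensorHom_def, MonoidalCategory.whiskerLeft_comp,
    whisker_exchange_assoc, Category.comp_id]

omit [HasCoproducts.{w} M] [SymmetricCategory M] [MonoidalClosed M] in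
-- Multiplicativity of `pathMap`; it is what makes the extension to the free precategory compatible
-- with laxity.
theorem pathMap_append {A B C : X} (p : ChainPath A B) (q : ChainPath B C) :
    p.tensorAppend k q ≫ pathMap φ (p.append q) ≫
        (G.diag A C).map (eqToHom (p.total_append q)) =
      (pathMap φ p ⊗ₘ pathMap φ q) ≫ G.lax p.total q.total := by
  induction p with
  | @single A B s =>
    change 𝟙 _ ≫ ((φ _ _ s ⊗ₘ pathMap φ q) ≫ G.lax s q.total) ≫ (G.diag A C).map (𝟙 _) =
      (φ _ _ s ⊗ₘ pathMap φ q) ≫ G.lax s q.total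
    simp
  | @cons A B' B s p ih =>
    have h1 : (G.lax s p.total ▷ (G.diag B C).obj q.total) ≫ G.lax (s.concat p.total) q.total =
        (α_ _ _ _).hom ≫ ((G.diag A B').obj s ◁ G.lax p.total q.total) ≫
          G.lax s (p.total.concat q.total) ≫
            (G.diag A C).map (eqToHom (Chain.concat_assoc s p.total q.total).symm) := by
      have := G.lax_assoc s p.total q.total
      rw [← reassoc_of% this, ← Functor.map_comp, eqToHom_trans, eqToHom_refl,
        CategoryTheory.Functor.map_id, Category.comp_id]
    have h2 : G.lax s (p.append q).total ≫ (G.diag A C).map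
        (eqToHom ((ChainPath.cons s p).total_append q)) =
        ((G.diag A B').obj s ◁ (G.diag B' C).map (eqToHom (p.total_append q))) ≫
          G.lax s (p.total.concat q.total) ≫
            (G.diag A C).map (eqToHom (Chain.concat_assoc s p.total q.total).symm) := by
      rw [← reassoc_of% (lax_eqToHom (G := G) s (p.total_append q)), ← Functor.map_comp,
        eqToHom_trans]
      rfl
    exact pathMap_append_aux (ih q) h1 h2

/-- The components of the morphism from a free precategory that a family of morphisms
determines. -/
noncomputable def liftApp {A B : X} (t : Chain A B) : obj k t ⟶ (G.diag A B).obj t :=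
  desc k fun p σ => pathMap φ p ≫ (G.diag A B).map σ

omit [SymmetricCategory M] [MonoidalClosed M] in
theorem ι_liftApp {A B : X} {t : Chain A B} (p : ChainPath A B) (σ : p.total ⟶ t) :
    ι k p σ ≫ liftApp φ t = pathMap φ p ≫ (G.diag A B).map σ :=
  ι_desc k _ p σ

omit [SymmetricCategory M] [MonoidalClosed M] in
theorem map_liftApp {A B : X} {t t' : Chain A B} (f : t ⟶ t') :
    map k f ≫ liftApp φ t' = liftApp φ t ≫ (G.diag A B).map f :=
  hom_ext k fun p σ => by
    rw [reassoc_of% (ι_map k p σ f), ι_liftApp, reassoc_of% (ι_liftApp φ p σ), Functor.map_comp]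

theorem lax_liftApp {A B C : X} (s : Chain A B) (t : Chain B C) :
    lax k s t ≫ liftApp φ (s.concat t) = (liftApp φ s ⊗ₘ liftApp φ t) ≫ G.lax s t := by
  apply (jointlyEpic_inc k s).tensorHom (jointlyEpic_inc k t)
  rintro ⟨⟨p, σ⟩, ⟨q, τ⟩⟩
  dsimp only [inc]
  rw [reassoc_of% (ι_lax k p σ q τ), ι_liftApp, tensorHom_comp_tensorHom_assoc, ι_liftApp,
    ι_liftApp,
    ← tensorHom_comp_tensorHom_assoc, G.lax_naturality, concatIndex, Functor.map_comp]
  exact (reassoc_of% (pathMap_append φ p q)) _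

/-- The morphism from a free precategory that a family of morphisms determines. -/
noncomputable def lift : precat k ⟶ G :=
  ({ app _ _ :=
      { app t := liftApp φ t
        naturality _ _ f := map_liftApp φ f }
     lax_comm s t := lax_liftApp φ s t } : Precat.Hom (precat k) G)

end Lift

/-- The inclusion of the generators into a free precategory. -/
noncomputable def unit {A B : X} (s : Chain A B) : k A B s ⟶ obj k s :=
  ι k (.single s) (𝟙 s)

omit [SymmetricCategory M] [MonoidalClosed M] in
theorem unit_liftApp {G : Precat M X}
    (φ : ∀ (A B : X) (s : Chain A B), k A B s ⟶ (G.diag A B).obj s) {A B : X} (s : Chain A B) :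
    unit k s ≫ liftApp φ s = φ A B s :=
  (ι_liftApp φ (.single s) (𝟙 s)).trans
    ((congrArg _ ((G.diag A B).map_id s)).trans (Category.comp_id _))

/-- The component at a chain of a morphism from a free precategory. -/
def homApp {G : Precat M X} (f : precat k ⟶ G) {A B : X} (t : Chain A B) :
    obj k t ⟶ (G.diag A B).obj t :=
  (f.app A B).app t

/-- Uniqueness in the universal property: naturality reduces to `σ = 𝟙`, and laxity then peels the
chains off the path one by one, down to generators. -/
theorem ι_homApp {G : Precat M X} (f : precat k ⟶ G) {A B : X} {t : Chain A B}
    (p : ChainPath A B) (σ : p.total ⟶ t) :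
    ι k p σ ≫ homApp k f t = pathMap (fun _ _ s => unit k s ≫ homApp k f s) p ≫
      (G.diag A B).map σ := by
  have hmap (t : Chain A B) (σ : p.total ⟶ t) :
      ι k p σ ≫ homApp k f t = (ι k p (𝟙 _) ≫ homApp k f p.total) ≫ (G.diag A B).map σ := by
    have h : map k σ ≫ homApp k f t = homApp k f p.total ≫ (G.diag A B).map σ :=
      (f.app A B).naturality σ
    rw [Category.assoc, ← h, reassoc_of% (ι_map k p (𝟙 _) σ)]
  rw [hmap]
  congr 1
  clear σ hmap t
  induction p with
  | single s => rfl
  | @cons A C B s p ih =>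
    have h : lax k s p.total ≫ homApp k f (s.concat p.total) =
      (homApp k f s ⊗ₘ homApp k f p.total) ≫ G.lax s p.total := f.lax_comm s p.total
    -- The summand of a longer path is the product, under the laxity map, of a generator and the
    -- summand of the shorter path.
    have h1 : ι k (.cons s p) (𝟙 (s.concat p.total)) =
        (unit k s ⊗ₘ ι k p (𝟙 _)) ≫ lax k s p.total := by
      refine Eq.trans ?_ (ι_lax k (.single s) (𝟙 s) p (𝟙 _)).symm
      refine Eq.trans ?_ (Category.id_comp _).symm
      exact congrArg (ι k (.cons s p))
        ((Category.id_comp _).trans (Chain.concatMap_id s p.total)).symm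
    have h2 : ((unit k s ⊗ₘ ι k p (𝟙 _)) ≫ lax k s p.total) ≫ homApp k f (s.concat p.total) =
        ((unit k s ≫ homApp k f s) ⊗ₘ pathMap (fun _ _ s => unit k s ≫ homApp k f s) p) ≫
          G.lax s p.total := by
      rw [Category.assoc, h, tensorHom_comp_tensorHom_assoc, ih]
    exact (congrArg (fun g => g ≫ homApp k f (s.concat p.total)) h1).trans h2

/-- Morphisms from a free precategory correspond to families of morphisms. -/
noncomputable def homEquiv (G : Precat M X) :
    (precat k ⟶ G) ≃ ∀ (A B : X) (s : Chain A B), k A B s ⟶ (G.diag A B).obj s where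
  toFun f _ _ s := unit k s ≫ homApp k f s
  invFun φ := lift φ
  left_inv f := by
    ext A B t
    refine hom_ext k fun p σ => ?_
    exact (ι_liftApp _ p σ).trans (ι_homApp k f p σ).symm
  right_inv φ := by
    funext A B s
    exact unit_liftApp k φ s

end Free

namespace Precat

variable (M : Type u) [Category.{v} M] [MonoidalCategory M] (X : Type w)

/-- The functor that takes a precategory to the family of its values. -/
@[simps]
def values : Precat M X ⥤ (Discrete (Σ A B : X, Chain A B) ⥤ M) where
  obj F := Discrete.functor fun i => (F.diag i.1 i.2.1).obj i.2.2
  map f := Discrete.natTrans fun i => (f.app i.as.1 i.as.2.1).app i.as.2.2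

variable [SymmetricCategory M] [MonoidalClosed M] [HasCoproducts.{w} M]

/-- The universal property of free precategories. -/
noncomputable def valuesHomEquiv (K : Discrete (Σ A B : X, Chain A B) ⥤ M) (G : Precat M X) :
    (Free.precat (fun A B s => K.obj ⟨⟨A, B, s⟩⟩) ⟶ G) ≃ (K ⟶ (values M X).obj G) :=
  (Free.homEquiv _ G).trans
    { toFun φ := Discrete.natTrans fun i => φ i.as.1 i.as.2.1 i.as.2.2
      invFun α A B s := α.app ⟨⟨A, B, s⟩⟩
      left_inv _ := rfl
      right_inv _ := rfl }

instance isRightAdjoint_values : (values M X).IsRightAdjoint :=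
  (Adjunction.adjunctionOfEquivLeft (valuesHomEquiv M X) (by
    intro K G G' g f
    ext i
    exact (Category.assoc _ _ _).symm)).isRightAdjoint

end Precat

end CoSegal

namespace CoSegal

/-- A functor that preserves the colimits indexed by the walking reflexive pair preserves reflexive
coequalizers. -/
theorem preservesColimitOfIsReflexivePair {C D : Type*} [Category.{v} C] [Category.{v} D]
    (V : C ⥤ D) [PreservesColimitsOfShape WalkingReflexivePair V] :
    Monad.PreservesColimitOfIsReflexivePair V where
  out _ _ f g _ :=
    preservesColimit_of_iso_diagram V (inclusionWalkingReflexivePairOfIsReflexivePairIso f g)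

namespace Precat

/-! ### Colimits of precategories -/

section

variable {M : Type u} [Category.{v} M] [MonoidalCategory M] {X : Type w}

instance reflectsIsomorphisms_values : (values M X).ReflectsIsomorphisms where
  reflects {F G} f _ := by
    have h (A B : X) (s : Chain A B) : IsIso ((f.app A B).app s) :=
      inferInstanceAs (IsIso (((values M X).map f).app ⟨⟨A, B, s⟩⟩))
    exact isIso_of_isIso_app f

variable [SymmetricCategory M] [MonoidalClosed M]

instance preservesColimitsOfShape_values {K : Type*} [Category* K] [HasColimitsOfShape K M]
    [IsSifted K] : PreservesColimitsOfShape K (values M X) :=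
  preservesColimitsOfShape_of_evaluation _ _ fun i =>
    inferInstanceAs (PreservesColimitsOfShape K (ev M i.as.2.2))

variable [HasColimitsOfSize.{w, w} M]

instance hasColimitsOfShape_walkingReflexivePair :
    HasColimitsOfShape WalkingReflexivePair (Precat M X) := by
  have : HasColimitsOfSize.{0, 0} M := hasColimitsOfSizeShrink.{0, 0, w, w} M
  infer_instance

/-- The constant-diagram functor acquires a left adjoint by adjoint lifting: after passing to values
it becomes the constant-diagram functor of a cocomplete category. The lifting theorem needs
reflexive coequalizers in precategories and monadicity of `V`, and Beck's criterion supplies the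
latter since `V` is a right adjoint that reflects isomorphisms and preserves reflexive coequalizers.
-/
instance hasColimitsOfShape {K : Type w} [SmallCategory K] :
    HasColimitsOfShape K (Precat M X) := by
  have : HasColimitsOfSize.{0, 0} M := hasColimitsOfSizeShrink.{0, 0, w, w} M
  let V := (Functor.whiskeringRight K _ _).obj (values M X)
  have : HasReflexiveCoequalizers (Precat M X) :=
    hasReflexiveCoequalizers_iff.1 inferInstance
  have : HasReflexiveCoequalizers (K ⥤ Precat M X) :=
    hasReflexiveCoequalizers_iff.1 inferInstance
  have : V.ReflectsIsomorphisms := inferInstance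
  have : Monad.PreservesColimitOfIsReflexivePair V := preservesColimitOfIsReflexivePair V
  let adj := (Adjunction.ofIsRightAdjoint (values M X)).whiskerRight K
  let _ : MonadicRightAdjoint V :=
    Monad.monadicOfHasPreservesReflexiveCoequalizersOfReflectsIsomorphisms adj
  have : (Functor.const K (C := Discrete (Σ A B : X, Chain A B) ⥤ M)).IsRightAdjoint :=
    hasColimitsOfShape_iff_isRightAdjoint_const.1 inferInstance
  rw [hasColimitsOfShape_iff_isRightAdjoint_const]
  exact isRightAdjoint_square_lift_monadic (Functor.const K) V (values M X)
    (Functor.const K) (Iso.refl _)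

instance isRightAdjoint_ev {A B : X} (s : Chain A B) : (ev M s).IsRightAdjoint :=
  inferInstanceAs (values M X ⋙ (evaluation _ _).obj ⟨⟨A, B, s⟩⟩).IsRightAdjoint

end

end Precat

namespace Pointed

variable {M : Type u} [Category.{v} M] [MonoidalCategory M] [SymmetricCategory M]
  [MonoidalClosed M] [HasInitial M] {X : Type w} [HasColimitsOfSize.{w, w} M]

/-- The left adjoint of forgetting the point is the coproduct with `I_X`; this provides the functors
`Υ`. -/
instance hasBinaryCoproducts : HasBinaryCoproducts (Precat M X) := by
  have : HasColimitsOfSize.{w, w} (Precat M X) := ⟨inferInstance⟩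
  have : HasColimitsOfSize.{0, 0} (Precat M X) := hasColimitsOfSizeShrink.{0, 0, w, w} _
  infer_instance

instance hasPushouts : HasPushouts (Pointed M X) := by
  have : HasColimitsOfSize.{w, w} (Precat M X) := ⟨inferInstance⟩
  have : HasColimitsOfSize.{0, 0} (Precat M X) := hasColimitsOfSizeShrink.{0, 0, w, w} _
  infer_instance

instance isRightAdjoint_ev {A B : X} (s : Chain A B) : (ev M s).IsRightAdjoint :=
  inferInstanceAs (Under.forget _ ⋙ Precat.ev M s).IsRightAdjoint

/-- Filtered shapes are both sifted and connected, so neither the laxity maps nor the point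
obstructs pointwise computation. The convergence of the enforcing sequences rests on this. -/
instance preservesColimitsOfShape_ev {K : Type w} [SmallCategory K] [IsFiltered K] {A B : X}
    (s : Chain A B) : PreservesColimitsOfShape K (ev M s) := by
  have : IsSifted K := IsFiltered.isSifted
  exact inferInstanceAs (PreservesColimitsOfShape K (Under.forget _ ⋙ Precat.ev M s))

end Pointed

end CoSegal

namespace CoSegal

/-! ### Projections from local maps -/

section Abstract

variable {C : Type u} [Category.{v} C]

/-- If every object is the source of a morphism in `V`, and the morphisms in `V` are local with
respect to `W` with target in `W`, then there is an endofunctor with a natural transformation from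
the identity that has components in `V`. -/
theorem exists_functor_of_isLocal (W : ObjectProperty C) (V : MorphismProperty C)
    (hV : ∀ F : C, ∃ (G : C) (f : F ⟶ G), V f)
    (hW : ∀ ⦃F G : C⦄ (f : F ⟶ G), V f → W G ∧ W.isLocal f) :
    ∃ (P : C ⥤ C) (η : 𝟭 C ⟶ P), ∀ F, V (η.app F) := by
  choose Q e he using hV
  -- The action on `f` is the unique extension of `f ≫ e G` along the local map `e F`; uniqueness
  -- yields functoriality.
  choose m hm using fun {F G : C} (f : F ⟶ G) =>
    ((hW _ (he F)).2 (Q G) (hW _ (he G)).1).2 (f ≫ e G)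
  dsimp only at hm
  refine ⟨{ obj := Q, map := m, map_id F := ?_, map_comp {F G H} f g := ?_ },
    { app := e, naturality _ _ f := (hm f).symm }, he⟩
  · exact ((hW _ (he F)).2 _ (hW _ (he F)).1).1 (by simp [hm])
  · refine ((hW _ (he F)).2 _ (hW _ (he H)).1).1 ?_
    dsimp only
    rw [hm, reassoc_of% (hm f), hm, Category.assoc]

theorem exists_transfiniteCompositionsOfShape (J : Type w) [LinearOrder J] [OrderBot J]
    [SuccOrder J] [WellFoundedLT J] [HasIterationOfShape J C] (W : MorphismProperty C)
    (hW : ∀ F : C, ∃ (G : C) (δ : F ⟶ G), W δ) (F : C) :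
    ∃ (G : C) (f : F ⟶ G), W.transfiniteCompositionsOfShape J f := by
  choose succ toSucc h using hW
  let Φ : SmallObject.SuccStruct C := { X₀ := F, succ := succ, toSucc := toSucc }
  refine ⟨_, Φ.ιIteration J, ⟨(Φ.transfiniteCompositionOfShapeιIteration J).ofLE ?_⟩⟩
  intro G _ f hf
  cases hf
  exact h _

theorem exists_gluingStep [HasWidePushouts.{w} C] {S : Type w} (P : S → C ⥤ C)
    (η : ∀ i, 𝟭 C ⟶ P i) (F : C) : ∃ (G : C) (δ : F ⟶ G), gluingStep P η δ := by
  let D := WidePushoutShape.wideSpan F (fun i => (P i).obj F) (fun i => (η i).app F)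
  refine ⟨colimit D, colimit.ι D none, fun i => colimit.ι D (some i),
    fun i => colimit.w D (WidePushoutShape.Hom.init i), ⟨?_⟩⟩
  refine IsColimit.ofIsoColimit (colimit.isColimit D) (Cocone.ext (Iso.refl _) ?_)
  rintro (_ | i) <;> exact Category.comp_id _

/-- The map to a wide pushout of local maps is local. -/
theorem gluingStep_le_isLocal {S : Type*} {P : S → C ⥤ C} {η : ∀ i, 𝟭 C ⟶ P i}
    {W : ObjectProperty C} (h : ∀ i F, W.isLocal ((η i).app F)) :
    gluingStep P η ≤ W.isLocal := by
  rintro F G δ ⟨ε, hε, ⟨hc⟩⟩ Z hZ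
  refine ⟨fun g g' hg => hc.hom_ext ?_, fun f => ?_⟩
  · rintro (_ | i)
    · exact hg
    · refine (h i F Z hZ).1 ?_
      change (η i).app F ≫ ε i ≫ g = (η i).app F ≫ ε i ≫ g'
      rw [reassoc_of% (hε i), reassoc_of% (hε i)]
      exact hg
  · choose k hk using fun i => (h i F Z hZ).2 f
    exact ⟨hc.desc (WidePushoutShape.mkCocone f k hk), hc.fac _ none⟩

end Abstract

/-! ### Unity constraints -/

section Step

variable {M : Type u} [Category.{v} M] [MonoidalCategory M] [SymmetricCategory M]
  [MonoidalClosed M] [HasInitial M] {X : Type w}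

/-- The value of the pushout of `L(j)` along a counit, for an adjunction `L ⊣ R`. -/
theorem map_eq_of_isPushout_counit {C D : Type*} [Category* C] [Category* D] {L : C ⥤ D}
    {R : D ⥤ C} (adj : L ⊣ R) {F G : D} {m : C} {j : R.obj F ⟶ m} {δ : F ⟶ G} {ξ : L.obj m ⟶ G}
    (sq : IsPushout (adj.counit.app F) (L.map j) δ ξ) :
    R.map δ = j ≫ adj.unit.app m ≫ R.map ξ := by
  rw [← adj.unit_naturality_assoc, ← Functor.map_comp, ← sq.w, Functor.map_comp,
    adj.right_triangle_components_assoc]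

section

variable {A B : X} {z : Chain A B} {F G : Pointed M X} {T : M}
  {a b : T ⟶ (Pointed.ev M z).obj F} {δ : F ⟶ G}

theorem IsEnforcingPushout.comp_eq (h : IsEnforcingPushout z a b δ) :
    a ≫ (Pointed.ev M z).map δ = b ≫ (Pointed.ev M z).map δ := by
  obtain ⟨Υ, adj, m, j, hj, -, ξ, sq⟩ := h
  have key := map_eq_of_isPushout_counit adj sq
  rw [key, reassoc_of% hj]

/-- By the pushout and the adjunction, extending `f` along `δ` amounts to factoring the value of `f`
at `z` through the coequalizer `j`. Such a factorization exists uniquely as soon as that value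
coequalizes `a` and `b`. -/
theorem IsEnforcingPushout.bijective (h : IsEnforcingPushout z a b δ) {Q : Pointed M X}
    (hQ : ∀ f : F ⟶ Q, a ≫ (Pointed.ev M z).map f = b ≫ (Pointed.ev M z).map f) :
    Function.Bijective fun g : G ⟶ Q => δ ≫ g := by
  obtain ⟨Υ, adj, m, j, hj, ⟨hc⟩, ξ, sq⟩ := h
  have key := map_eq_of_isPushout_counit adj sq
  refine ⟨fun g g' hg => sq.hom_ext hg ?_, fun f => ?_⟩
  · apply (adj.homEquiv _ _).injective
    refine Cofork.IsColimit.hom_ext hc ?_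
    dsimp only at hg
    simp only [Cofork.π_ofπ, adj.homEquiv_unit, Functor.map_comp]
    have := congrArg (Pointed.ev M z).map hg
    simpa only [Functor.map_comp, key, Category.assoc] using this
  · obtain ⟨d, hd⟩ := Cofork.IsColimit.desc' hc _ (hQ f)
    refine ⟨sq.desc f ((adj.homEquiv _ _).symm d) ?_, sq.inl_desc _ _ _⟩
    rw [← adj.homEquiv_naturality_left_symm]
    simp only [Cofork.π_ofπ] at hd
    rw [hd, adj.homEquiv_counit, adj.counit_naturality]

theorem exists_isEnforcingPushout [HasColimitsOfSize.{w, w} M] (z : Chain A B)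
    (a b : T ⟶ (Pointed.ev M z).obj F) :
    ∃ (G : Pointed M X) (δ : F ⟶ G), IsEnforcingPushout z a b δ := by
  have : HasColimitsOfSize.{0, 0} M := hasColimitsOfSizeShrink.{0, 0, w, w} M
  let adj := Adjunction.ofIsRightAdjoint (Pointed.ev M z)
  exact ⟨_, pushout.inl _ _, _, adj, _, coequalizer.π a b, coequalizer.condition a b,
    ⟨coequalizerIsCoequalizer a b⟩, _, IsPushout.of_hasPushout _ _⟩

end

namespace Pointed

theorem pt_naturality {F G : Pointed M X} (f : F ⟶ G) (A : X) :
    F.pt A ≫ (f.right.app A A).app (Chain.edge A A) = G.pt A := by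
  rw [pt, pt, ← Under.w f]
  exact Category.assoc _ _ _

theorem leftMul_naturality {F G : Pointed M X} (f : F ⟶ G) {A B : X} (s : Chain A B) :
    (𝟙_ M ◁ (f.right.app A B).app s) ≫ G.right.leftMul G.pt s =
      F.right.leftMul F.pt s ≫ (f.right.app A B).app ((Chain.edge A A).concat s) := by
  rw [Precat.leftMul, Precat.leftMul, Category.assoc, f.right.lax_comm, ← pt_naturality f]
  simp only [MonoidalCategory.tensorHom_def, comp_whiskerRight, Category.assoc]
  rw [whisker_exchange_assoc, whisker_exchange_assoc]

theorem rightMul_naturality {F G : Pointed M X} (f : F ⟶ G) {A B : X} (s : Chain A B) :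
    ((f.right.app A B).app s ▷ 𝟙_ M) ≫ G.right.rightMul G.pt s =
      F.right.rightMul F.pt s ≫ (f.right.app A B).app (s.concat (Chain.edge B B)) := by
  rw [Precat.rightMul, Precat.rightMul, Category.assoc, f.right.lax_comm, ← pt_naturality f]
  simp only [MonoidalCategory.tensorHom_def', MonoidalCategory.whiskerLeft_comp, Category.assoc]
  rw [whisker_exchange_assoc, whisker_exchange_assoc]

theorem leftInsertion_naturality {F G : Pointed M X} (f : F ⟶ G) {A B : X} {s t : Chain A B}
    (σ : s ⟶ t) :
    (𝟙_ M ◁ (f.right.app A B).app s) ≫ (λ_ _).hom ≫ (G.right.diag A B).map σ =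
      ((λ_ _).hom ≫ (F.right.diag A B).map σ) ≫ (f.right.app A B).app t := by
  rw [leftUnitor_naturality_assoc, Category.assoc, NatTrans.naturality]

theorem rightInsertion_naturality {F G : Pointed M X} (f : F ⟶ G) {A B : X} {s t : Chain A B}
    (σ : s ⟶ t) :
    ((f.right.app A B).app s ▷ 𝟙_ M) ≫ (ρ_ _).hom ≫ (G.right.diag A B).map σ =
      ((ρ_ _).hom ≫ (F.right.diag A B).map σ) ≫ (f.right.app A B).app t := by
  rw [rightUnitor_naturality_assoc, Category.assoc, NatTrans.naturality]

end Pointed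

namespace UnityConstraint

/-- The common source of the two maps that a unity constraint compares. -/
noncomputable def source : UnityConstraint X → (Pointed M X ⥤ M)
  | left s _ => Pointed.ev M s ⋙ tensorLeft (𝟙_ M)
  | right s _ => Pointed.ev M s ⋙ tensorRight (𝟙_ M)

/-- The common target of the two maps that a unity constraint compares. -/
noncomputable def target : UnityConstraint X → (Pointed M X ⥤ M)
  | left (A := A) s _ => Pointed.ev M ((Chain.edge A A).concat s)
  | right (B := B) s _ => Pointed.ev M (s.concat (Chain.edge B B))

/-- The map of a unity constraint given by insertion of a letter. -/
noncomputable def viaInsertion : (i : UnityConstraint X) → (source (M := M) i ⟶ target i)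
  | left (A := A) (B := B) _ σ =>
    { app F := (λ_ _).hom ≫ (F.right.diag A B).map σ
      naturality _ _ f := Pointed.leftInsertion_naturality f σ }
  | right (A := A) (B := B) _ σ =>
    { app F := (ρ_ _).hom ≫ (F.right.diag A B).map σ
      naturality _ _ f := Pointed.rightInsertion_naturality f σ }

/-- The map of a unity constraint given by multiplication with a unity. -/
noncomputable def viaUnit : (i : UnityConstraint X) → (source (M := M) i ⟶ target i)
  | left s _ =>
    { app F := F.right.leftMul F.pt s
      naturality _ _ f := Pointed.leftMul_naturality f s }
  | right s _ =>
    { app F := F.right.rightMul F.pt s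
      naturality _ _ f := Pointed.rightMul_naturality f s }

/-- A pointed precategory satisfies a unity constraint. -/
def Holds (i : UnityConstraint X) : ObjectProperty (Pointed M X) :=
  fun F => i.viaInsertion.app F = i.viaUnit.app F

theorem comp_eq_of_enforcingStep (i : UnityConstraint X) {F G : Pointed M X} {δ : F ⟶ G}
    (h : enforcingStep i δ) :
    i.viaInsertion.app F ≫ i.target.map δ = i.viaUnit.app F ≫ i.target.map δ := by
  cases i <;> exact IsEnforcingPushout.comp_eq h

theorem exists_enforcingStep [HasColimitsOfSize.{w, w} M] (i : UnityConstraint X)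
    (F : Pointed M X) : ∃ (G : Pointed M X) (δ : F ⟶ G), enforcingStep i δ := by
  cases i <;> exact exists_isEnforcingPushout _ _ _

/-- Naturality of both compared maps moves the question from `F` to `Q`. -/
theorem Holds.comp_eq {i : UnityConstraint X} {F Q : Pointed M X} (hQ : i.Holds Q) (f : F ⟶ Q) :
    i.viaInsertion.app F ≫ i.target.map f = i.viaUnit.app F ≫ i.target.map f := by
  rw [← NatTrans.naturality, ← NatTrans.naturality, hQ]

theorem enforcingStep_le_isLocal (i : UnityConstraint X) :
    enforcingStep i ≤ (i.Holds (M := M)).isLocal := by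
  intro F G δ h Q hQ
  cases i <;> exact IsEnforcingPushout.bijective h fun f => hQ.comp_eq f

instance isClosedUnderIsomorphisms_holds (i : UnityConstraint X) :
    (i.Holds (M := M)).IsClosedUnderIsomorphisms where
  of_iso {F G} e h := by
    have := h
    rw [Holds, ← cancel_epi (i.source.map e.hom), NatTrans.naturality, NatTrans.naturality, h]

instance preservesColimitsOfShape_source [HasColimitsOfSize.{w, w} M] (i : UnityConstraint X)
    {K : Type w} [SmallCategory K] [IsFiltered K] :
    PreservesColimitsOfShape K (i.source (M := M)) := by
  cases i <;> exact comp_preservesColimitsOfShape _ _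

variable [HasColimitsOfSize.{w, w} M] {J : Type w} [LinearOrder J] [OrderBot J] [SuccOrder J]
  [WellFoundedLT J] [NoMaxOrder J]

/-- A transfinite composition of maps that coequalize the two maps of a unity constraint ends at an
object that satisfies it. -/
theorem holds_of_transfiniteComposition (i : UnityConstraint X) {F G : Pointed M X} {f : F ⟶ G}
    {W : MorphismProperty (Pointed M X)} (hf : W.transfiniteCompositionsOfShape J f)
    (hW : ∀ ⦃F G : Pointed M X⦄ (δ : F ⟶ G), W δ →
      i.viaInsertion.app F ≫ i.target.map δ = i.viaUnit.app F ≫ i.target.map δ) : i.Holds G := by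
  obtain ⟨h⟩ := hf
  -- The sources of the two maps at `G` form the colimit of those at the stages, so agreement can be
  -- tested stage by stage.
  refine (isColimitOfPreserves i.source h.isColimit).hom_ext fun j => ?_
  change i.source.map (h.incl.app j) ≫ _ = i.source.map (h.incl.app j) ≫ _
  -- Stage `j` reaches the colimit through the next step, which coequalizes the two maps formed at
  -- `j`. The absence of a maximal stage guarantees a genuine step.
  have e : h.incl.app j = h.F.map (homOfLE (Order.le_succ j)) ≫ h.incl.app (Order.succ j) := by
    simp
  have key : i.viaInsertion.app (h.F.obj j) ≫ i.target.map (h.incl.app j) =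
      i.viaUnit.app (h.F.obj j) ≫ i.target.map (h.incl.app j) := by
    rw [e, Functor.map_comp, reassoc_of% (hW _ (h.map_mem j (not_isMax j)))]
  exact (i.viaInsertion.naturality _).trans (key.trans (i.viaUnit.naturality _).symm)

variable {i : UnityConstraint X} {P : Pointed M X ⥤ Pointed M X} {η : 𝟭 _ ⟶ P}

theorem holds_of_isUnitEnforcing (h : IsUnitEnforcing J i P η) (F : Pointed M X) :
    i.Holds (P.obj F) :=
  holds_of_transfiniteComposition i (h F) fun _ _ _ => comp_eq_of_enforcingStep i

omit [HasColimitsOfSize.{w, w} M] [NoMaxOrder J] in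
theorem isLocal_of_transfiniteComposition (i : UnityConstraint X) {F G : Pointed M X} {f : F ⟶ G}
    (hf : (enforcingStep i).transfiniteCompositionsOfShape J f) : i.Holds.isLocal f :=
  MorphismProperty.transfiniteCompositionsOfShape_le _ _ _
    (MorphismProperty.transfiniteCompositionsOfShape_monotone J (enforcingStep_le_isLocal i) _ hf)

omit [HasColimitsOfSize.{w, w} M] [NoMaxOrder J] in
theorem isLocal_of_isUnitEnforcing (h : IsUnitEnforcing J i P η) (F : Pointed M X) :
    i.Holds.isLocal (η.app F) :=
  i.isLocal_of_transfiniteComposition (h F)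

end UnityConstraint

end Step

end CoSegal

namespace CoSegal

variable {M : Type u} [Category.{v} M] [MonoidalCategory M]

/-! ### Truncation of precategories to the chains with two letters -/

section Truncation

variable [SymmetricCategory M] [MonoidalClosed M] [HasInitial M] {X : Type w}

variable (M) in
/-- In a closed symmetric monoidal category with an initial object `∅`, the internal hom `[∅, ∅]` is
terminal. -/
noncomputable def isTerminalIhomInitial : IsTerminal ((ihom (⊥_ M)).obj (⊥_ M)) :=
  IsTerminal.ofUniqueHom
    (fun Y => MonoidalClosed.curry ((isInitialTensorRight initialIsInitial Y).to _))
    fun Y _ => MonoidalClosed.uncurry_injective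
      ((isInitialTensorRight initialIsInitial Y).hom_ext _ _)

namespace Trunc

/-- The values of the truncation: those of `F` at chains with two letters, and terminal
elsewhere. -/
noncomputable def obj (F : Precat M X) {A B : X} : Chain A B → M
  | ⟨[]⟩ => (F.diag A B).obj (Chain.edge A B)
  | ⟨_ :: _⟩ => (ihom (⊥_ M)).obj (⊥_ M)

/-- The truncation is terminal at chains with more than two letters. -/
noncomputable def isTerminalObj (F : Precat M X) {A B : X} (s : Chain A B) (hs : s.mid ≠ []) :
    IsTerminal (obj F s) :=
  match s, hs with
  | ⟨_ :: _⟩, _ => isTerminalIhomInitial M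

/-- The truncation is terminal at concatenations. -/
noncomputable def isTerminalConcat (F : Precat M X) {A B C : X} (s : Chain A B) (t : Chain B C) :
    IsTerminal (obj F (s.concat t)) :=
  isTerminalObj F _ (by simp [Chain.concat])

/-- The functoriality of the truncation in the chain. -/
noncomputable def map (F : Precat M X) {A B : X} : {s t : Chain A B} → (s ⟶ t) →
    (obj F s ⟶ obj F t)
  | ⟨[]⟩, ⟨[]⟩, _ => 𝟙 _
  -- Insertions never shorten a word, so no morphism leads from a longer chain back to a two-letter
  -- one.
  | ⟨_ :: _⟩, ⟨[]⟩, f => nomatch (show Ins _ [] from f)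
  | _, ⟨_ :: _⟩, _ => (isTerminalIhomInitial M).from _

/-- The components of the truncation. -/
noncomputable def diag (F : Precat M X) (A B : X) : Chain A B ⥤ M where
  obj := obj F
  map := map F
  map_id
    | ⟨[]⟩ => rfl
    | ⟨_ :: _⟩ => (isTerminalIhomInitial M).hom_ext _ _
  map_comp {r s t} f g :=
    match r, s, t, f, g with
    | ⟨[]⟩, ⟨[]⟩, ⟨[]⟩, _, _ => (Category.comp_id _).symm
    | ⟨_ :: _⟩, ⟨[]⟩, ⟨[]⟩, f, _ => nomatch (show Ins _ [] from f)
    | _, ⟨_ :: _⟩, ⟨[]⟩, _, g => nomatch (show Ins _ [] from g)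
    | _, _, ⟨_ :: _⟩, _, _ => (isTerminalIhomInitial M).hom_ext _ _

end Trunc

/-- The truncation of a precategory: its values at chains with more than two letters are
terminal. -/
noncomputable def trunc (F : Precat M X) : Precat M X where
  diag := Trunc.diag F
  lax s t := (Trunc.isTerminalConcat F s t).from _
  lax_naturality _ _ := (Trunc.isTerminalConcat F _ _).hom_ext _ _
  lax_assoc r s t := (Trunc.isTerminalConcat F r (s.concat t)).hom_ext _ _

namespace Trunc

variable {F H : Precat M X}

theorem hom_ext {f g : H ⟶ trunc F}
    (h : ∀ A B, (f.app A B).app (Chain.edge A B) = (g.app A B).app (Chain.edge A B)) : f = g := by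
  ext A B ⟨_ | ⟨a, l⟩⟩
  · exact h A B
  · exact (isTerminalIhomInitial M).hom_ext _ _

/-- The components of a morphism to a truncation. -/
noncomputable def liftApp (u : ∀ A B, (H.diag A B).obj (Chain.edge A B) ⟶
    (F.diag A B).obj (Chain.edge A B)) {A B : X} : (s : Chain A B) → ((H.diag A B).obj s ⟶ obj F s)
  | ⟨[]⟩ => u A B
  | ⟨_ :: _⟩ => (isTerminalIhomInitial M).from _

/-- Morphisms to a truncation are given by their components at chains with two letters. -/
noncomputable def lift (u : ∀ A B, (H.diag A B).obj (Chain.edge A B) ⟶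
    (F.diag A B).obj (Chain.edge A B)) : H ⟶ trunc F :=
  ({ app A B :=
      { app := liftApp u
        naturality s t f :=
          match s, t, f with
          | ⟨[]⟩, ⟨[]⟩, f => by
            rw [Chain.fromEdge_unique f (𝟙 (Chain.edge A B))]
            exact (congrArg (fun g => g ≫ u A B) ((H.diag A B).map_id _)).trans
              ((Category.id_comp _).trans (Category.comp_id _).symm)
          | ⟨_ :: _⟩, ⟨[]⟩, f => nomatch (show Ins _ [] from f)
          | _, ⟨_ :: _⟩, _ => (isTerminalIhomInitial M).hom_ext _ _ }
     lax_comm s t := (isTerminalConcat F s t).hom_ext _ _ } : Precat.Hom H (trunc F))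

end Trunc

namespace Pointed

/-- The truncation of a pointed precategory. -/
noncomputable def trunc (F : Pointed M X) : Pointed M X :=
  Under.mk (F.hom ≫ Trunc.lift fun _ _ => 𝟙 _)

/-- The compared maps have a terminal target, since a concatenation always has an interior letter.
-/
theorem holds_trunc (F : Pointed M X) (i : UnityConstraint X) : i.Holds F.trunc := by
  cases i with
  | @left A _ s _ => exact (Trunc.isTerminalConcat F.right (Chain.edge A A) s).hom_ext _ _
  | @right _ B s _ => exact (Trunc.isTerminalConcat F.right s (Chain.edge B B)).hom_ext _ _

/-- The component of a morphism of pointed precategories at a chain with two letters. -/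
noncomputable abbrev edgeApp {F G : Pointed M X} (f : F ⟶ G) (A B : X) :
    (F.right.diag A B).obj (Chain.edge A B) ⟶ (G.right.diag A B).obj (Chain.edge A B) :=
  (f.right.app A B).app (Chain.edge A B)

/-- The unit of a pointed precategory at a chain with two letters. -/
noncomputable abbrev homEdge (F : Pointed M X) (A B : X) :
    discHom M A B ⟶ (F.right.diag A B).obj (Chain.edge A B) :=
  (F.hom.app A B).app (Chain.edge A B)

theorem homEdge_edgeApp {F G : Pointed M X} (f : F ⟶ G) (A B : X) :
    F.homEdge A B ≫ edgeApp f A B = G.homEdge A B :=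
  congrArg (fun g => (Precat.Hom.app g A B).app (Chain.edge A B)) (Under.w f)

/-- Morphisms to a truncation are given by their components at chains with two letters. -/
noncomputable def truncLift {F H : Pointed M X}
    (u : ∀ A B, (H.right.diag A B).obj (Chain.edge A B) ⟶ (F.right.diag A B).obj (Chain.edge A B))
    (hu : ∀ A B, H.homEdge A B ≫ u A B = F.homEdge A B) :
    H ⟶ F.trunc :=
  Under.homMk (Trunc.lift u) (Trunc.hom_ext fun A B =>
    (hu A B).trans (Category.comp_id (F.homEdge A B)).symm)

/-- The component at a chain with two letters of a morphism to a truncation. -/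
noncomputable def truncApp {F H : Pointed M X} (f : H ⟶ F.trunc) (A B : X) :
    (H.right.diag A B).obj (Chain.edge A B) ⟶ (F.right.diag A B).obj (Chain.edge A B) :=
  (f.right.app A B).app (Chain.edge A B)

theorem trunc_hom_ext {F H : Pointed M X} {f g : H ⟶ F.trunc}
    (h : ∀ A B, truncApp f A B = truncApp g A B) : f = g :=
  Under.UnderMorphism.ext (Trunc.hom_ext h)

theorem truncApp_comp {F G H : Pointed M X} (f : G ⟶ H) (g : H ⟶ F.trunc) (A B : X) :
    truncApp (f ≫ g) A B = edgeApp f A B ≫ truncApp g A B := rfl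

theorem truncApp_truncLift {F H : Pointed M X}
    (u : ∀ A B, (H.right.diag A B).obj (Chain.edge A B) ⟶ (F.right.diag A B).obj (Chain.edge A B))
    (hu : ∀ A B, H.homEdge A B ≫ u A B = F.homEdge A B)
    (A B : X) : truncApp (truncLift u hu) A B = u A B := rfl

theorem homEdge_truncApp {F H : Pointed M X} (f : H ⟶ F.trunc) (A B : X) :
    H.homEdge A B ≫ truncApp f A B = F.homEdge A B :=
  (homEdge_edgeApp f A B).trans (Category.comp_id _)

/-- A map that is local with respect to truncations is an isomorphism at chains with two letters. -/
theorem isIso_edgeApp_of_isLocal {W : ObjectProperty (Pointed M X)}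
    (hW : ∀ F : Pointed M X, W F.trunc)
    {F G : Pointed M X} {δ : F ⟶ G} (hδ : W.isLocal δ) (A B : X) : IsIso (edgeApp δ A B) := by
  -- Extending the canonical map from `F` to its truncation along `δ` gives a left inverse of `δ` on
  -- two-letter chains.
  obtain ⟨r, hr⟩ := (hδ _ (hW F)).2 (truncLift (fun _ _ => 𝟙 _) (by simp))
  replace hr (A B : X) : edgeApp δ A B ≫ truncApp r A B = 𝟙 _ := by
    rw [← truncApp_comp]
    exact congrArg (fun f => truncApp f A B) hr
  -- For the other composite, two maps from `G` to its own truncation agree after precomposition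
  -- with `δ`, hence agree.
  have key : truncLift (fun A B => truncApp r A B ≫ edgeApp δ A B)
      (fun A B => by rw [← Category.assoc, homEdge_truncApp, homEdge_edgeApp]) =
      truncLift (F := G) (fun _ _ => 𝟙 _) (by simp) := by
    refine (hδ _ (hW G)).1 (trunc_hom_ext fun A B => ?_)
    dsimp only
    rw [truncApp_comp, truncApp_comp, truncApp_truncLift, truncApp_truncLift, ← Category.assoc, hr,
      Category.id_comp, Category.comp_id]
  exact ⟨truncApp r A B, hr A B, congrArg (fun f => truncApp f A B) key⟩

end Pointed

end Truncation

/-! ### Strongly unital precategories as pointed precategories -/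

section StronglyUnital

variable [SymmetricCategory M] [MonoidalClosed M] [HasInitial M] {X : Type w}

variable (M X) in
/-- The pointed precategories that satisfy all unity constraints. -/
def AllHold : ObjectProperty (Pointed M X) := fun F => ∀ i : UnityConstraint X, i.Holds F

namespace AllHold

/-- A pointed precategory that satisfies all unity constraints is strongly unital. -/
noncomputable def toStronglyUnital {F : Pointed M X} (h : AllHold M X F) : StronglyUnital M X where
  toPrecat := F.right
  unit := F.pt
  left_unital s σ := (h (.left s σ)).symm
  right_unital s σ := (h (.right s σ)).symm

/-- As `I_X` is locally constant, naturality along the morphism from the two-letter chain determines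
the point from its two-letter components; those off the diagonal have initial source. -/
theorem pointApp_toStronglyUnital {F : Pointed M X} (h : AllHold M X F) {A B : X} (s : Chain A B) :
    h.toStronglyUnital.pointApp s = (F.hom.app A B).app s := by
  by_cases hAB : A = B
  · subst hAB
    have h1 : F.homEdge A A ≫ (F.right.diag A A).map (Chain.fromEdge s) = (F.hom.app A A).app s :=
      ((F.hom.app A A).naturality (Chain.fromEdge s)).symm.trans (Category.id_comp _)
    rw [StronglyUnital.pointApp_self, ← h1]
    change (discSelf M A).inv ≫ ((discSelf M A).hom ≫ F.homEdge A A) ≫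
      (F.right.diag A A).map (Chain.fromEdge s) = _
    simp
  · exact (discInitial hAB).hom_ext _ _

/-- A pointed precategory that satisfies all unity constraints is in the image of the strongly
unital ones. -/
noncomputable def iso {F : Pointed M X} (h : AllHold M X F) :
    StronglyUnital.toPointed.obj h.toStronglyUnital ≅ F :=
  Under.isoMk (Iso.refl _) ((Category.comp_id _).trans
    (Precat.hom_ext fun _ _ s => h.pointApp_toStronglyUnital s))

end AllHold

theorem StronglyUnital.allHold_toPointed (F : StronglyUnital M X) :
    AllHold M X (toPointed.obj F) := by
  have hpt : Pointed.pt (toPointed.obj F) = F.unit := funext F.toPointed_pt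
  rintro (⟨s, σ⟩ | ⟨s, σ⟩)
  · change (λ_ _).hom ≫ (F.toPrecat.diag _ _).map σ = F.toPrecat.leftMul _ s
    rw [hpt, F.left_unital s σ]
  · change (ρ_ _).hom ≫ (F.toPrecat.diag _ _).map σ = F.toPrecat.rightMul _ s
    rw [hpt, F.right_unital s σ]

instance AllHold.isClosedUnderIsomorphisms : (AllHold M X).IsClosedUnderIsomorphisms where
  of_iso e h i := i.Holds.prop_of_iso e (h i)

theorem essImage_toPointed :
    (StronglyUnital.toPointed (M := M) (X := X)).essImage = AllHold M X := by
  ext F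
  constructor
  · rintro ⟨G, ⟨e⟩⟩
    exact (AllHold M X).prop_of_iso e G.allHold_toPointed
  · exact fun h => ⟨_, ⟨h.iso⟩⟩

end StronglyUnital

/-! ### Reflections -/

section Reflection

variable {C : Type u} [Category.{v} C] {W : ObjectProperty C} {Φ : C ⥤ C} {η : 𝟭 C ⟶ Φ}

/-- A local map between objects of `W` is invertible; both isomorphism claims are instances of this.
-/
theorem isMonadicProjection_of_isLocal (hmem : ∀ F, W (Φ.obj F)) (hη : ∀ F, W.isLocal (η.app F)) :
    IsMonadicProjection W Φ η where
  mem := hmem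
  isIso_of_mem F hF := (W.isLocal_iff_isIso _ hF (hmem F)).1 (hη F)
  isIso_map F := by
    refine (W.isLocal_iff_isIso _ (hmem F) (hmem _)).1 (W.isLocal.of_precomp (η.app F) _ (hη F) ?_)
    -- `Φ(η_F)` is local by cancellation: its precomposite with the local map `η_F` is a composite
    -- of two local maps.
    have : η.app F ≫ Φ.map (η.app F) = η.app F ≫ η.app (Φ.obj F) := (η.naturality (η.app F)).symm
    rw [this]
    exact W.isLocal.comp_mem _ _ (hη _) (hη _)

/-- A functor with local maps to it factors through a left adjoint of a fully faithful functor. -/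
theorem exists_adjunction_of_isLocal {D : Type*} [Category* D] (U : D ⥤ C) [U.Full] [U.Faithful]
    (hU : ∀ G, W (U.obj G)) (Q : C → D) (e : ∀ F, U.obj (Q F) ≅ Φ.obj F)
    (hη : ∀ F, W.isLocal (η.app F)) :
    ∃ (Φ' : C ⥤ D) (e : Φ' ⋙ U ≅ Φ) (adj : Φ' ⊣ U),
      ∀ F, adj.unit.app F ≫ e.hom.app F = η.app F := by
  let Φ' : C ⥤ D :=
    { obj := Q
      map f := U.preimage ((e _).hom ≫ Φ.map f ≫ (e _).inv)
      map_id F := U.map_injective (by simp)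
      map_comp f g := U.map_injective (by simp) }
  let α : Φ' ⋙ U ≅ Φ := NatIso.ofComponents e (fun f => by simp [Φ'])
  -- The hom-bijection composes full faithfulness of `U`, transport along `e F`, and locality of
  -- `η_F`.
  let eqv (F : C) (G : D) : (Q F ⟶ G) ≃ (F ⟶ U.obj G) :=
    Equiv.ofBijective (fun g => η.app F ≫ (e F).inv ≫ U.map g)
      ((hη F _ (hU G)).comp ((e F).homFromEquiv.bijective.comp
        ((Functor.FullyFaithful.ofFullyFaithful U).map_bijective _ _)))
  have heqv {F : C} {G : D} (g : Q F ⟶ G) : eqv F G g = η.app F ≫ (e F).inv ≫ U.map g := rfl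
  let adj : Φ' ⊣ U := Adjunction.mkOfHomEquiv
    { homEquiv := eqv
      homEquiv_naturality_left_symm {F' F G} f g := by
        obtain ⟨g, rfl⟩ := (eqv F G).surjective g
        have h := (η.naturality_assoc f ((e F).inv ≫ U.map g)).symm
        rw [Equiv.symm_apply_eq, Equiv.symm_apply_apply, heqv, heqv]
        simpa [Φ'] using h.symm
      homEquiv_naturality_right g g' := by simp [heqv] }
  refine ⟨Φ', α, adj, fun F => ?_⟩
  have : adj.unit.app F = η.app F ≫ (e F).inv ≫ U.map (𝟙 _) :=
    (Adjunction.mkOfHomEquiv_unit_app _ F).trans rfl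
  rw [this]
  simp [α]

end Reflection

end CoSegal

namespace CoSegal

/-! ### Existence and properties of the projections and of their gluing -/

variable {M : Type u} [Category.{v} M] [MonoidalCategory M] [SymmetricCategory M]
  [MonoidalClosed M] [HasInitial M] {X : Type w} {J : Type w} [LinearOrder J] [OrderBot J]
  [SuccOrder J] [WellFoundedLT J]

variable {P : UnityConstraint X → Pointed M X ⥤ Pointed M X} {ηP : ∀ i, 𝟭 _ ⟶ P i}

/-- Each `η_i` is local against objects satisfying constraint `i`, a fortiori against those
satisfying all constraints; wide pushouts and transfinite composition preserve this. -/
theorem isLocal_of_transfiniteComposition_gluingStep (hP : ∀ i, IsUnitEnforcing J i (P i) (ηP i))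
    {F G : Pointed M X} {f : F ⟶ G}
    (hf : (gluingStep P ηP).transfiniteCompositionsOfShape J f) : (AllHold M X).isLocal f :=
  MorphismProperty.transfiniteCompositionsOfShape_le _ _ _
    (MorphismProperty.transfiniteCompositionsOfShape_monotone J
      (gluingStep_le_isLocal fun i F Q hQ =>
        UnityConstraint.isLocal_of_isUnitEnforcing (hP i) F Q (hQ i)) _ hf)

variable [HasColimitsOfSize.{w, w} M] [NoMaxOrder J]

/-- For every `i`, each gluing step factors through `P_i`, whose values satisfy constraint `i`. Thus
every step coequalizes the two maps of every constraint simultaneously. -/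
theorem allHold_of_transfiniteComposition_gluingStep
    (hP : ∀ i, IsUnitEnforcing J i (P i) (ηP i)) {F G : Pointed M X} {f : F ⟶ G}
    (hf : (gluingStep P ηP).transfiniteCompositionsOfShape J f) : AllHold M X G := by
  intro i
  refine UnityConstraint.holds_of_transfiniteComposition i hf ?_
  rintro F G δ ⟨ε, hε, -⟩
  rw [← hε i, Functor.map_comp,
    reassoc_of% ((UnityConstraint.holds_of_isUnitEnforcing (hP i) F).comp_eq ((ηP i).app F))]

theorem UnityConstraint.exists_isUnitEnforcing (i : UnityConstraint X) :
    ∃ (P : Pointed M X ⥤ Pointed M X) (η : 𝟭 _ ⟶ P), IsUnitEnforcing J i P η :=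
  exists_functor_of_isLocal i.Holds _
    (exists_transfiniteCompositionsOfShape J _ i.exists_enforcingStep)
    fun _ _ _ hf => ⟨i.holds_of_transfiniteComposition hf fun _ _ _ => i.comp_eq_of_enforcingStep,
      i.isLocal_of_transfiniteComposition hf⟩

theorem exists_isGluing (hP : ∀ i, IsUnitEnforcing J i (P i) (ηP i)) :
    ∃ (Φ : Pointed M X ⥤ Pointed M X) (η : 𝟭 _ ⟶ Φ), IsGluing J P ηP Φ η :=
  exists_functor_of_isLocal (AllHold M X) _
    (exists_transfiniteCompositionsOfShape J _ (exists_gluingStep P ηP))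
    fun _ _ _ hf => ⟨allHold_of_transfiniteComposition_gluingStep hP hf,
      isLocal_of_transfiniteComposition_gluingStep hP hf⟩

end CoSegal

theorem mainTheorem7 {M : Type u} [Category.{v} M] [MonoidalCategory M] [SymmetricCategory M]
    [MonoidalClosed M] [IsLocallyPresentable.{w} M] (X : Type w)
    (J : Type w) [LinearOrder J] [OrderBot J] [SuccOrder J] [WellFoundedLT J] [NoMaxOrder J] :
    (∃ (P : CoSegal.UnityConstraint X → CoSegal.Pointed M X ⥤ CoSegal.Pointed M X)
        (ηP : ∀ i, 𝟭 _ ⟶ P i), ∀ i, CoSegal.IsUnitEnforcing J i (P i) (ηP i)) ∧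
    ∀ (P : CoSegal.UnityConstraint X → CoSegal.Pointed M X ⥤ CoSegal.Pointed M X)
      (ηP : ∀ i, 𝟭 _ ⟶ P i), (∀ i, CoSegal.IsUnitEnforcing J i (P i) (ηP i)) →
      (∃ (Φ : CoSegal.Pointed M X ⥤ CoSegal.Pointed M X) (η : 𝟭 _ ⟶ Φ),
        CoSegal.IsGluing J P ηP Φ η) ∧
      ∀ (Φ : CoSegal.Pointed M X ⥤ CoSegal.Pointed M X) (η : 𝟭 _ ⟶ Φ),
        CoSegal.IsGluing J P ηP Φ η →
        (∃ (Φ' : CoSegal.Pointed M X ⥤ CoSegal.StronglyUnital M X)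
            (e : Φ' ⋙ CoSegal.StronglyUnital.toPointed ≅ Φ)
            (adj : Φ' ⊣ CoSegal.StronglyUnital.toPointed),
            ∀ F, adj.unit.app F ≫ e.hom.app F = η.app F) ∧
        (∀ (F : CoSegal.Pointed M X) (A B : X),
          IsIso ((CoSegal.Pointed.ev M (CoSegal.Chain.edge A B)).map (η.app F))) ∧
        CoSegal.IsMonadicProjection
          (CoSegal.StronglyUnital.toPointed (M := M) (X := X)).essImage Φ η := by
  obtain ⟨κ, hκ, hM⟩ := IsLocallyPresentable.exists_cardinal.{w} M
  have : HasColimitsOfSize.{w, w} M := inferInstance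
  have hQ := CoSegal.UnityConstraint.exists_isUnitEnforcing (M := M) (X := X) (J := J)
  refine ⟨⟨fun i => (hQ i).choose, fun i => (hQ i).choose_spec.choose,
    fun i => (hQ i).choose_spec.choose_spec⟩, fun P ηP hP =>
      ⟨CoSegal.exists_isGluing hP, fun Φ η h => ?_⟩⟩
  have hmem := fun F => CoSegal.allHold_of_transfiniteComposition_gluingStep hP (h F)
  have hη := fun F => CoSegal.isLocal_of_transfiniteComposition_gluingStep hP (h F)
  refine ⟨CoSegal.exists_adjunction_of_isLocal CoSegal.StronglyUnital.toPointed
    CoSegal.StronglyUnital.allHold_toPointed _ (fun F => (hmem F).iso) hη, fun F A B =>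
      CoSegal.Pointed.isIso_edgeApp_of_isLocal (fun F i => F.holds_trunc i) (hη F) A B, ?_⟩
  -- The essential image is the class of objects satisfying all constraints, against which locality
  -- was established.
  rw [CoSegal.essImage_toPointed]
  exact CoSegal.isMonadicProjection_of_isLocal hmem hη
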